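/- **Setting.** Consider, for $k=0,1,2,\dots$, the nonlinear system with additive noise $$x_{k+1}=f(x_k,u_k)+w_k,\qquad y_k=h_k(x_k)+\eta_k,\qquad x_k\in\mathbb R^n,\; y_k\in\mathbb R^p,$$ with known (deterministic) inputs $u_k$ and measurable $f(\cdot,u_k)$, $h_k$ (in the time-invariant case $h_k=h$). The random vectors $x_0,w_0,w_1,\dots,\eta_0,\eta_1,\dots$ are mutually independent and have positive Lebesgue densities; for example $w_k\sim\mathcal N(0,Q_k)$ and $\eta_k\sim\mathcal N(0,R_k)$ with $Q_k,R_k\succ0$. Let $p(x_0)$, $p(x_{k+1}\mid x_k)$ and $p(y_k\mid x_k)$ be the resulting prior, transition and measurement densities, and suppose that their logarithms are twice differentiable in the states. For $m\ge 0$ let $$p_m=p(x_{0:m},y_{0:m-1})=p(x_0)\prod_{i=0}^{m-1}p(x_{i+1}\mid x_i)\prod_{j=0}^{m-1}p(y_j\mid x_j)$$ be the joint density of the trajectory up to time $m$ and the measurements before time $m$, and write its information matrix in blocks, $$\mathbb E\!\left[-\frac{\partial^2\log p_m}{\partial x_{0:m}\,\partial x_{0:m}^T}\right]=\begin{bmatrix}A_m&B_m\\B_m^T&C_m\end{bmatrix},$$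 where $A_m$ belongs to $x_{0:m-1}$ and $C_m$ to $x_m$. The predictive information matrix of $x_m$ is the inverse of the right-lower block of the inverse of this matrix, $\check J_{x_m}=C_m-B_m^TA_m^{-1}B_m$ (so $\check J_{x_0}=C_0$). **Statement.** The initial value is $$\check J_{x_0}=\mathbb E\!\left[-\frac{\partial^2\log p(x_0)}{\partial x_0\,\partial x_0^T}\right].$$ For every $k=0,1,2,\dots$ the matrix $\check J_{x_{k+1}}$ obeys the recursion $$\check J_{x_{k+1}}=D^{22}_{k+1}-D^{21}_{k+1}\left(D^{11}_{k+1}+\check J_{x_k}\right)^{-1}D^{12}_{k+1},$$ where $$D^{11}_{k+1}=\mathbb E\!\left[-\frac{\partial^2\log p(x_{k+1}\mid x_k)}{\partial x_k\,\partial x_k^T}-\frac{\partial^2\log p(y_k\mid x_k)}{\partial x_k\,\partial x_k^T}\right],\qquad D^{12}_{k+1}=\mathbb E\!\left[-\frac{\partial^2\log p(x_{k+1}\mid x_k)}{\partial x_k\,\partial x_{k+1}^T}\right],$$ $$D^{21}_{k+1}=(D^{12}_{k+1})^T,\qquad D^{22}_{k+1}=\mathbb E\!\left[-\frac{\partial^2\log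 p(x_{k+1}\mid x_k)}{\partial x_{k+1}\,\partial x_{k+1}^T}\right].$$ Moreover, for every one-step-ahead predictor $\check x_{k+1}=g(y_0,\dots,y_k)$ of $x_{k+1}$, with $g$ measurable, the error correlation matrix is bounded below in the Loewner order: $$\check P_{x_{k+1}}=\mathbb E\!\left[(\check x_{k+1}-x_{k+1})(\check x_{k+1}-x_{k+1})^T\right]\succcurlyeq\left(\check J_{x_{k+1}}\right)^{-1}.$$ Here it is assumed that the expectations exist (those of the prior Hessian, of the $D$ blocks up to index $k+1$, and of $\check P_{x_{k+1}}$) and that $A_{k+1}$, $D^{11}_{k+1}+\check J_{x_k}$ and $\check J_{x_{k+1}}$ are invertible. -/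

import Mathlib

open MeasureTheory ProbabilityTheory

noncomputable section

namespace PredictivePCRB

/-! ### Derivatives and expectations of matrices -/

/-- A real function that is (Fréchet) differentiable everywhere, and whose derivative is
differentiable everywhere. -/
def TwiceDifferentiable {E : Type*} [NormedAddCommGroup E] [NormedSpace ℝ E] (φ : E → ℝ) : Prop :=
  Differentiable ℝ φ ∧ Differentiable ℝ (fderiv ℝ φ)

/-- The first partial derivative of `φ` at `x` in the coordinate `a`. -/
def partialDeriv {κ : Type*} [Fintype κ] [DecidableEq κ] (φ : (κ → ℝ) → ℝ) (a : κ)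
    (x : κ → ℝ) : ℝ :=
  fderiv ℝ φ x (Pi.single a 1)

/-- The Hessian matrix of `φ` at `x`, with entries `∂² φ / ∂ x_a ∂ x_b`. -/
def hessian {κ : Type*} [Fintype κ] [DecidableEq κ] (φ : (κ → ℝ) → ℝ) (x : κ → ℝ) :
    Matrix κ κ ℝ :=
  Matrix.of fun a b => partialDeriv (fun z => partialDeriv φ b z) a x

/-- The mixed second derivative `∂² φ / ∂ x ∂ x'ᵀ` of a function of two vectors, at `(x, x')`,
with entries `∂² φ / ∂ x_a ∂ x'_b`. -/
def mixedHessian {κ : Type*} [Fintype κ] [DecidableEq κ] (φ : (κ → ℝ) → (κ → ℝ) → ℝ)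
    (x x' : κ → ℝ) : Matrix κ κ ℝ :=
  Matrix.of fun a b => partialDeriv (fun z => partialDeriv (fun z' => φ z z') b x') a x

/-- The entrywise expectation of a random matrix. -/
def expectation {Ω : Type*} [MeasurableSpace Ω] (μ : Measure Ω) {κ κ' : Type*}
    (M : Ω → Matrix κ κ' ℝ) : Matrix κ κ' ℝ :=
  Matrix.of fun a b => ∫ ω, M ω a b ∂μ

/-- The expectation of a random matrix exists: all entries are integrable. -/
def HasExpectation {Ω : Type*} [MeasurableSpace Ω] (μ : Measure Ω) {κ κ' : Type*}
    (M : Ω → Matrix κ κ' ℝ) : Prop :=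
  ∀ a b, Integrable (fun ω => M ω a b) μ

/-! ### The system -/

/-- The data of a nonlinear system with additive noise, with `n`-dimensional state,
`p`-dimensional measurements and (deterministic) control inputs in `U`:
`x_{k+1} = f (x_k, u_k) + w_k`, `y_k = h_k (x_k) + η_k`, where `x_0`, `w_k`, `η_k` have the
Lebesgue densities `prior`, `q k`, `r k`. -/
structure System (n p : ℕ) (U : Type*) where
  f : (Fin n → ℝ) → U → (Fin n → ℝ)
  u : ℕ → U
  h : ℕ → (Fin n → ℝ) → (Fin p → ℝ)
  prior : (Fin n → ℝ) → ℝ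
  q : ℕ → (Fin n → ℝ) → ℝ
  r : ℕ → (Fin p → ℝ) → ℝ

namespace System

variable {n p : ℕ} {U : Type*} (S : System n p U)

/-- The transition density `p(x_{k+1} | x_k)`, at `x_k = x` and `x_{k+1} = x'`. -/
def transDensity (k : ℕ) (x x' : Fin n → ℝ) : ℝ := S.q k (x' - S.f x (S.u k))

/-- The measurement density `p(y_k | x_k)`, at `x_k = x` and `y_k = y`. -/
def measDensity (k : ℕ) (x : Fin n → ℝ) (y : Fin p → ℝ) : ℝ := S.r k (y - S.h k x)

/-- The joint density `p(x_0, …, x_m, y_0, …, y_{m-1})`. The trajectory is a vector with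
coordinates indexed by (time, component). -/
def jointDensity (m : ℕ) (x : Fin (m + 1) × Fin n → ℝ) (y : Fin m → Fin p → ℝ) : ℝ :=
  S.prior (fun a => x (0, a))
    * (∏ i : Fin m, S.transDensity i (fun a => x (i.castSucc, a)) (fun a => x (i.succ, a)))
    * ∏ j : Fin m, S.measDensity j (fun a => x (j.castSucc, a)) (y j)

/-- The standing regularity assumptions: the system functions and the densities are measurable,
the densities are positive, and the derivatives of first and second order, with respect to the
states, of the logarithms of `p(x_0)`, `p(x_{k+1} | x_k)` and `p(y_k | x_k)` exist. -/
structure Regular : Prop where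
  measurable_f : ∀ k, Measurable fun x => S.f x (S.u k)
  measurable_h : ∀ k, Measurable (S.h k)
  measurable_prior : Measurable S.prior
  measurable_q : ∀ k, Measurable (S.q k)
  measurable_r : ∀ k, Measurable (S.r k)
  prior_pos : ∀ x, 0 < S.prior x
  q_pos : ∀ k w, 0 < S.q k w
  r_pos : ∀ k v, 0 < S.r k v
  diff_prior : TwiceDifferentiable fun x => Real.log (S.prior x)
  diff_trans : ∀ k, TwiceDifferentiable fun z : (Fin n → ℝ) × (Fin n → ℝ) =>
    Real.log (S.transDensity k z.1 z.2)
  diff_meas : ∀ k y, TwiceDifferentiable fun x => Real.log (S.measDensity k x y)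

/-! ### The random process -/

variable {Ω : Type*} [MeasurableSpace Ω]

/-- The random sequences `X` (states), `Y` (measurements), `W` (process noise) and `N`
(measurement noise) follow the system `S`: the system equations hold, `x_0`, `w_k`, `η_k` have the
prescribed densities, and `x_0, w_0, w_1, …, η_0, η_1, …` are mutually independent. -/
structure Follows (μ : Measure Ω) (X : ℕ → Ω → Fin n → ℝ) (Y : ℕ → Ω → Fin p → ℝ)
    (W : ℕ → Ω → Fin n → ℝ) (N : ℕ → Ω → Fin p → ℝ) : Prop where
  state_eq : ∀ k ω, X (k + 1) ω = S.f (X k ω) (S.u k) + W k ω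
  meas_eq : ∀ k ω, Y k ω = S.h k (X k ω) + N k ω
  measurable_init : Measurable (X 0)
  measurable_W : ∀ k, Measurable (W k)
  measurable_N : ∀ k, Measurable (N k)
  law_init : μ.map (X 0) = volume.withDensity fun x => ENNReal.ofReal (S.prior x)
  law_W : ∀ k, μ.map (W k) = volume.withDensity fun w => ENNReal.ofReal (S.q k w)
  law_N : ∀ k, μ.map (N k) = volume.withDensity fun v => ENNReal.ofReal (S.r k v)
  indep : iIndep
    (Sum.elim (fun _ : Unit => MeasurableSpace.comap (X 0) inferInstance)
      (Sum.elim (fun k : ℕ => MeasurableSpace.comap (W k) inferInstance)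
        (fun k : ℕ => MeasurableSpace.comap (N k) inferInstance))) μ

/-! ### Predictive information -/

variable (μ : Measure Ω) (X : ℕ → Ω → Fin n → ℝ) (Y : ℕ → Ω → Fin p → ℝ)

/-- The information matrix of the trajectory `x_{0:m}`: the expectation of
`- ∂² log p(x_{0:m}, y_{0:m-1}) / ∂ x_{0:m} ∂ x_{0:m}ᵀ`. -/
def infoMatrix (m : ℕ) : Matrix (Fin (m + 1) × Fin n) (Fin (m + 1) × Fin n) ℝ :=
  expectation μ fun ω =>
    -hessian (fun x => Real.log (S.jointDensity m x fun j => Y j ω)) (fun s => X s.1 ω s.2)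

/-- The block `A_m` of the information matrix, for `x_{0:m-1}` and `x_{0:m-1}`. -/
def blockA (m : ℕ) : Matrix (Fin m × Fin n) (Fin m × Fin n) ℝ :=
  Matrix.of fun s t => S.infoMatrix μ X Y m (s.1.castSucc, s.2) (t.1.castSucc, t.2)

/-- The block `B_m` of the information matrix, for `x_{0:m-1}` and `x_m`. -/
def blockB (m : ℕ) : Matrix (Fin m × Fin n) (Fin n) ℝ :=
  Matrix.of fun s b => S.infoMatrix μ X Y m (s.1.castSucc, s.2) (Fin.last m, b)

/-- The block `C_m` of the information matrix, for `x_m` and `x_m`. -/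
def blockC (m : ℕ) : Matrix (Fin n) (Fin n) ℝ :=
  Matrix.of fun a b => S.infoMatrix μ X Y m (Fin.last m, a) (Fin.last m, b)

/-- The predictive information matrix of `x_m`, that is, the Schur complement
`C_m - B_mᵀ A_m⁻¹ B_m`: the inverse of the right-lower block of the inverse information matrix
of the trajectory. For `m = 0` the blocks `A_0`, `B_0` are empty. -/
def predInfo (m : ℕ) : Matrix (Fin n) (Fin n) ℝ :=
  S.blockC μ X Y m - (S.blockB μ X Y m).transpose * (S.blockA μ X Y m)⁻¹ * S.blockB μ X Y m

/-- The random matrix `- ∂² log p(x_0) / ∂ x_0 ∂ x_0ᵀ`. -/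
def priorHess (ω : Ω) : Matrix (Fin n) (Fin n) ℝ :=
  -hessian (fun x => Real.log (S.prior x)) (X 0 ω)

/-- The random matrix
`- ∂² log p(x_{k+1} | x_k) / ∂ x_k ∂ x_kᵀ - ∂² log p(y_k | x_k) / ∂ x_k ∂ x_kᵀ`. -/
def hess11 (k : ℕ) (ω : Ω) : Matrix (Fin n) (Fin n) ℝ :=
  -hessian (fun x => Real.log (S.transDensity k x (X (k + 1) ω))) (X k ω)
    - hessian (fun x => Real.log (S.measDensity k x (Y k ω))) (X k ω)

/-- The random matrix `- ∂² log p(x_{k+1} | x_k) / ∂ x_k ∂ x_{k+1}ᵀ`. -/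
def hess12 (k : ℕ) (ω : Ω) : Matrix (Fin n) (Fin n) ℝ :=
  -mixedHessian (fun x x' => Real.log (S.transDensity k x x')) (X k ω) (X (k + 1) ω)

/-- The random matrix `- ∂² log p(x_{k+1} | x_k) / ∂ x_{k+1} ∂ x_{k+1}ᵀ`. -/
def hess22 (k : ℕ) (ω : Ω) : Matrix (Fin n) (Fin n) ℝ :=
  -hessian (fun x' => Real.log (S.transDensity k (X k ω) x')) (X (k + 1) ω)

/-- The matrix `D¹¹_{k+1}`. -/
def D11 (k : ℕ) : Matrix (Fin n) (Fin n) ℝ := expectation μ (S.hess11 X Y k)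

/-- The matrix `D¹²_{k+1}`. -/
def D12 (k : ℕ) : Matrix (Fin n) (Fin n) ℝ := expectation μ (S.hess12 X k)

/-- The matrix `D²¹_{k+1}`. -/
def D21 (k : ℕ) : Matrix (Fin n) (Fin n) ℝ := (S.D12 μ X k).transpose

/-- The matrix `D²²_{k+1}`. -/
def D22 (k : ℕ) : Matrix (Fin n) (Fin n) ℝ := expectation μ (S.hess22 X k)

end System

/-- The error of the predictor `g (y_0, …, y_k)` of `x_{k+1}`. -/
def predError {Ω : Type*} {n p : ℕ} (X : ℕ → Ω → Fin n → ℝ) (Y : ℕ → Ω → Fin p → ℝ) (k : ℕ)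
    (g : (Fin (k + 1) → Fin p → ℝ) → Fin n → ℝ) (ω : Ω) : Fin n → ℝ :=
  (g fun j => Y j ω) - X (k + 1) ω

/-- The random matrix `e eᵀ`, where `e` is the error of the predictor `g (y_0, …, y_k)` of
`x_{k+1}`. -/
def errorOuter {Ω : Type*} {n p : ℕ} (X : ℕ → Ω → Fin n → ℝ) (Y : ℕ → Ω → Fin p → ℝ) (k : ℕ)
    (g : (Fin (k + 1) → Fin p → ℝ) → Fin n → ℝ) (ω : Ω) : Matrix (Fin n) (Fin n) ℝ :=
  Matrix.vecMulVec (predError X Y k g ω) (predError X Y k g ω)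

end PredictivePCRB

end

noncomputable section

namespace PredictivePCRB

/-! ### Integration by parts against a positive density -/

section LineDerivative

/-! Recursion. Passing from time `m` to `m + 1` multiplies the joint density by factors that involve
only the last old state, the new state and one measurement. Hence the information matrix is block
tridiagonal in time: `A_{m+1}` is the whole information matrix at time `m` with `D¹¹` added in its
last corner, `B_{m+1}` has `D¹²` as its only nonzero block, in the last row, and `C_{m+1} = D²²`.
Eliminating the old states in two stages, first `x_{0:m-1}` and then `x_m`, turns the last corner
into `D¹¹` plus the previous Schur complement, which is the recursion (`predInfo_succ`).

Bound. This is the Van Trees argument. For a direction `v` of the trajectory let `s` be the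
derivative of the log joint density along `v`. Integration by parts gives `E[s²] = vᵀ I v`, with `I`
the information matrix, and `E[(a ⬝ e) s] = a ⬝ v_last` for the prediction error `e`, since the
predictor depends on the measurements alone. Expanding `0 ≤ E[(a ⬝ e + s)²]` at the optimal `v`
gives the bound.

Analysis. No boundary condition and no integrability of the score is assumed, only that the expected
Hessians exist. The identity `E[s²] = E[-∂s]` is first proved for the bounded damped score `s / (1 +
a s²)`. Letting `a → 0`, Fatou's lemma yields square integrability and dominated convergence yields
the identity (`memLp_score_and_integral_sq`). The expectations are integrals against the joint
density because `map_history` identifies the law of states and measurements, by induction on time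
from the independence of the noises. -/

lemma integrable_withDensity_exp_iff {E : Type*} [MeasurableSpace E] {ν : Measure E}
    {φ g : E → ℝ} (hφ : Measurable φ) :
    Integrable g (ν.withDensity fun z => ENNReal.ofReal (Real.exp (φ z))) ↔
      Integrable (fun z => Real.exp (φ z) * g z) ν := by
  rw [integrable_withDensity_iff_integrable_smul' hφ.exp.ennreal_ofReal (by simp)]
  simp [ENNReal.toReal_ofReal (Real.exp_pos _).le]

lemma integral_withDensity_exp {E : Type*} [MeasurableSpace E] {ν : Measure E}
    {φ : E → ℝ} (hφ : Measurable φ) (g : E → ℝ) :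
    ∫ z, g z ∂(ν.withDensity fun z => ENNReal.ofReal (Real.exp (φ z))) =
      ∫ z, Real.exp (φ z) * g z ∂ν := by
  rw [integral_withDensity_eq_integral_toReal_smul hφ.exp.ennreal_ofReal (by simp)]
  simp [ENNReal.toReal_ofReal (Real.exp_pos _).le]

variable {E : Type*} [NormedAddCommGroup E] [NormedSpace ℝ E] [MeasurableSpace E] [BorelSpace E]

/-- A line derivative is a pointwise limit of difference quotients. This gives joint measurability
of the score in states and measurements, although smoothness is known in the states only. -/
lemma measurable_of_hasLineDerivAt {φ s : E → ℝ} {v : E} (hφ : Measurable φ)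
    (hs : ∀ z, HasLineDerivAt ℝ φ (s z) z v) : Measurable s := by
  let a : ℕ → ℝ := fun k => 1 / ((k : ℝ) + 1)
  have ha : Filter.Tendsto a Filter.atTop (nhdsWithin 0 {0}ᶜ) :=
    tendsto_nhdsWithin_iff.2 ⟨tendsto_one_div_add_atTop_nhds_zero_nat,
      .of_forall fun k => by
        simp only [a, Set.mem_compl_iff, Set.mem_singleton_iff]
        positivity⟩
  refine measurable_of_tendsto_metrizable
    (f := fun k z => (a k)⁻¹ * (φ (z + a k • v) - φ z)) (fun k => ?_) ?_
  · have : Measurable fun z : E => z + a k • v := (continuous_add_const _).measurable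
    exact ((hφ.comp this).sub hφ).const_mul _
  · refine tendsto_pi_nhds.2 fun z => ?_
    have h := (hasDerivAt_iff_tendsto_slope.1 (hs z)).comp ha
    refine h.congr fun k => ?_
    simp [slope, Function.comp]

variable [FiniteDimensional ℝ E] {ν : Measure E} [ν.IsAddHaarMeasure]
  {φ s t : E → ℝ} {v : E}

/-- Integration by parts along `v` against the density `exp φ`, whose logarithmic derivative
along `v` is `s`. -/
lemma integral_lineDeriv_add_mul_score_eq_zero (hφ : Measurable φ)
    (hs : ∀ z, HasLineDerivAt ℝ φ (s z) z v) {g g' : E → ℝ}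
    (hg : ∀ z, HasLineDerivAt ℝ g (g' z) z v)
    (hgi : Integrable g (ν.withDensity fun z => ENNReal.ofReal (Real.exp (φ z))))
    (hgi' : Integrable (fun z => g' z + g z * s z)
      (ν.withDensity fun z => ENNReal.ofReal (Real.exp (φ z)))) :
    ∫ z, g' z + g z * s z ∂(ν.withDensity fun z => ENNReal.ofReal (Real.exp (φ z))) = 0 := by
  rw [integrable_withDensity_exp_iff hφ] at hgi hgi'
  rw [integral_withDensity_exp hφ]
  have hd : ∀ z, HasLineDerivAt ℝ (fun z => Real.exp (φ z) * g z)
      (Real.exp (φ z) * (g' z + g z * s z)) z v := fun z => by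
    have h1 := HasDerivAt.mul (HasDerivAt.exp (hs z)) (hg z)
    unfold HasLineDerivAt
    refine h1.congr_deriv ?_
    simp only [zero_smul, add_zero]
    ring
  -- Pairing with the constant function 1: an integrable function with integrable line derivative
  -- has a derivative of integral zero, without any decay condition.
  have := integral_bilinear_hasLineDerivAt_right_eq_neg_left_of_integrable (μ := ν)
    (f := fun _ : E => (1 : ℝ)) (f' := fun _ => (0 : ℝ)) (v := v)
    (g := fun z => Real.exp (φ z) * g z)
    (g' := fun z => Real.exp (φ z) * (g' z + g z * s z)) (B := ContinuousLinearMap.mul ℝ ℝ)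
    (by simp) (by simpa using hgi') (by simpa using hgi)
    (fun z _ => hasDerivAt_const _ _) (fun z _ => hd z)
  simpa using this

/-- Here `r` stands for the score and `r / (1 + a r²)` for its damped version. The last quotient is
the derivative of the damping in `r`; its bound does not depend on `a`, which is what permits the
limit `a → 0`. -/
lemma damped_score_bound {a r : ℝ} (ha : 0 < a) :
    |r / (1 + a * r ^ 2)| ≤ 1 + a⁻¹ ∧ 0 ≤ r ^ 2 / (1 + a * r ^ 2) ∧
      r ^ 2 / (1 + a * r ^ 2) ≤ a⁻¹ ∧ r ^ 2 / (1 + a * r ^ 2) ≤ r ^ 2 ∧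
      |(1 - a * r ^ 2) / (1 + a * r ^ 2) ^ 2| ≤ 1 := by
  have h0 : 0 ≤ a * r ^ 2 := by positivity
  have h1 : 0 < 1 + a * r ^ 2 := by positivity
  have hle : r ^ 2 / (1 + a * r ^ 2) ≤ a⁻¹ := by
    rw [div_le_iff₀ h1, mul_add, ← mul_assoc, inv_mul_cancel₀ ha.ne']
    have := inv_pos.2 ha
    linarith
  refine ⟨?_, by positivity, hle, div_le_self (by positivity) (by linarith), ?_⟩
  · have h2 : |r / (1 + a * r ^ 2)| ≤ 1 / (1 + a * r ^ 2) + r ^ 2 / (1 + a * r ^ 2) := by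
      rw [abs_div, abs_of_pos h1, ← add_div]
      gcongr
      rw [← sq_abs]
      nlinarith [abs_nonneg r, sq_nonneg (|r| - 1)]
    have h3 : 1 / (1 + a * r ^ 2) ≤ 1 := by
      rw [div_le_one h1]
      linarith
    linarith
  · rw [abs_div, abs_of_pos (pow_pos h1 2), div_le_one (pow_pos h1 2), abs_le]
    constructor <;> nlinarith

/-- The expectation of the square of the score is finite and equal to the expectation of the
negative second logarithmic derivative as soon as the latter exists. -/
theorem memLp_score_and_integral_sq (hφ : Measurable φ)
    (hs : ∀ z, HasLineDerivAt ℝ φ (s z) z v) (ht : ∀ z, HasLineDerivAt ℝ s (t z) z v)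
    [IsFiniteMeasure (ν.withDensity fun z => ENNReal.ofReal (Real.exp (φ z)))]
    (hti : Integrable t (ν.withDensity fun z => ENNReal.ofReal (Real.exp (φ z)))) :
    MemLp s 2 (ν.withDensity fun z => ENNReal.ofReal (Real.exp (φ z))) ∧
    ∫ z, s z ^ 2 ∂(ν.withDensity fun z => ENNReal.ofReal (Real.exp (φ z))) =
      ∫ z, -t z ∂(ν.withDensity fun z => ENNReal.ofReal (Real.exp (φ z))) := by
  have hsm : Measurable s := measurable_of_hasLineDerivAt hφ hs
  -- Integration by parts applied to the damped score, where every term is integrable: two are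
  -- bounded and the third is a bounded multiple of `t`.
  have key : ∀ a : ℝ, 0 < a → Integrable (fun z => s z ^ 2 / (1 + a * s z ^ 2))
        (ν.withDensity fun z => ENNReal.ofReal (Real.exp (φ z))) ∧
      ∫ z, s z ^ 2 / (1 + a * s z ^ 2)
        ∂(ν.withDensity fun z => ENNReal.ofReal (Real.exp (φ z))) =
      ∫ z, (1 - a * s z ^ 2) / (1 + a * s z ^ 2) ^ 2 * -t z
        ∂(ν.withDensity fun z => ENNReal.ofReal (Real.exp (φ z))) := by
    intro a ha
    have hi1 : Integrable (fun z => s z / (1 + a * s z ^ 2))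
        (ν.withDensity fun z => ENNReal.ofReal (Real.exp (φ z))) :=
      .of_bound (by fun_prop : Measurable _).aestronglyMeasurable (1 + a⁻¹) (.of_forall fun z => (damped_score_bound ha).1)
    have hi2 : Integrable (fun z => s z ^ 2 / (1 + a * s z ^ 2))
        (ν.withDensity fun z => ENNReal.ofReal (Real.exp (φ z))) :=
      .of_bound (by fun_prop : Measurable _).aestronglyMeasurable a⁻¹ (.of_forall fun z => by
        obtain ⟨-, h1, h2, -⟩ := damped_score_bound (r := s z) ha
        rwa [Real.norm_of_nonneg h1])
    have hi3 : Integrable (fun z => (1 - a * s z ^ 2) / (1 + a * s z ^ 2) ^ 2 * t z)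
        (ν.withDensity fun z => ENNReal.ofReal (Real.exp (φ z))) :=
      hti.bdd_mul (by fun_prop : Measurable _).aestronglyMeasurable (.of_forall fun z => (damped_score_bound ha).2.2.2.2)
    have heq : ∀ z, s z ^ 2 / (1 + a * s z ^ 2) = s z / (1 + a * s z ^ 2) * s z := fun z => by
      ring
    have hd : ∀ z, HasLineDerivAt ℝ (fun z => s z / (1 + a * s z ^ 2))
        ((1 - a * s z ^ 2) / (1 + a * s z ^ 2) ^ 2 * t z) z v := fun z => by
      have h0 : (1 + a * s (z + (0 : ℝ) • v) ^ 2) ≠ 0 := by positivity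
      have h1 := HasDerivAt.div (ht z) (((HasDerivAt.pow (ht z) 2).const_mul a).const_add 1) h0
      unfold HasLineDerivAt
      refine h1.congr_deriv ?_
      simp only [zero_smul, add_zero, Pi.pow_apply]
      rw [div_mul_eq_mul_div]
      congr 1
      push_cast
      ring
    have := integral_lineDeriv_add_mul_score_eq_zero hφ hs hd hi1
      (hi3.add (by simpa only [heq] using hi2))
    rw [integral_add hi3 (by simpa only [heq] using hi2)] at this
    refine ⟨hi2, ?_⟩
    simp only [heq, mul_neg, integral_neg]
    linarith
  let a : ℕ → ℝ := fun k => 1 / ((k : ℝ) + 1)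
  have hapos : ∀ k, 0 < a k := fun k => by positivity
  have ha : Filter.Tendsto a Filter.atTop (nhds 0) := tendsto_one_div_add_atTop_nhds_zero_nat
  have hlim1 : ∀ z, Filter.Tendsto (fun k => s z ^ 2 / (1 + a k * s z ^ 2)) Filter.atTop
      (nhds (s z ^ 2)) := fun z => by
    have : Filter.Tendsto (fun k => s z ^ 2 / (1 + a k * s z ^ 2)) Filter.atTop
      (nhds (s z ^ 2 / (1 + 0 * s z ^ 2))) :=
      tendsto_const_nhds.div ((ha.mul_const _).const_add 1) (by simp)
    simpa using this
  have hlim2 : ∀ z, Filter.Tendsto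
      (fun k => (1 - a k * s z ^ 2) / (1 + a k * s z ^ 2) ^ 2 * -t z) Filter.atTop
      (nhds (-t z)) := fun z => by
    have : Filter.Tendsto (fun k => (1 - a k * s z ^ 2) / (1 + a k * s z ^ 2) ^ 2 * -t z)
      Filter.atTop (nhds ((1 - 0 * s z ^ 2) / (1 + 0 * s z ^ 2) ^ 2 * -t z)) :=
      (((ha.mul_const _).const_sub 1).div (((ha.mul_const _).const_add 1).pow 2)
        (by simp)).mul_const _
    simpa using this
  have hsq : Integrable (fun z => s z ^ 2)
      (ν.withDensity fun z => ENNReal.ofReal (Real.exp (φ z))) := by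
    refine ⟨by fun_prop, ?_⟩
    rw [hasFiniteIntegral_iff_ofReal (.of_forall fun z => sq_nonneg _)]
    refine lt_of_le_of_lt (b := ENNReal.ofReal
      (∫ z, ‖t z‖ ∂(ν.withDensity fun z => ENNReal.ofReal (Real.exp (φ z)))))
      ?_ ENNReal.ofReal_lt_top
    have hli : ∀ z, Filter.liminf
        (fun k => ENNReal.ofReal (s z ^ 2 / (1 + a k * s z ^ 2))) Filter.atTop =
        ENNReal.ofReal (s z ^ 2) := fun z =>
      ((ENNReal.continuous_ofReal.tendsto _).comp (hlim1 z)).liminf_eq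
    simp_rw [← hli]
    -- Fatou: by `key` each damped integral is at most `∫ ‖t‖`, uniformly in `k`.
    refine (lintegral_liminf_le fun k => by fun_prop).trans ?_
    refine Filter.liminf_le_of_frequently_le' (.of_forall fun k => ?_)
    rw [← ofReal_integral_eq_lintegral_ofReal (key _ (hapos k)).1
      (.of_forall fun z => (damped_score_bound (hapos k)).2.1), (key _ (hapos k)).2]
    refine ENNReal.ofReal_le_ofReal ((le_abs_self _).trans ?_)
    rw [← Real.norm_eq_abs]
    refine norm_integral_le_of_norm_le hti.norm (.of_forall fun z => ?_)
    rw [norm_mul, norm_neg]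
    exact mul_le_of_le_one_left (norm_nonneg _) (damped_score_bound (hapos k)).2.2.2.2
  refine ⟨(memLp_two_iff_integrable_sq hsm.aestronglyMeasurable).2 hsq, ?_⟩
  -- With `s²` now integrable, both sides of `key` converge dominatedly, the left one under `s²` and
  -- the right one under `‖t‖`.
  refine tendsto_nhds_unique (tendsto_integral_of_dominated_convergence (fun z => s z ^ 2)
    (fun k => (key _ (hapos k)).1.aestronglyMeasurable) hsq
    (fun k => .of_forall fun z => ?_) (.of_forall hlim1)) ?_
  · obtain ⟨-, h1, -, h2, -⟩ := damped_score_bound (r := s z) (hapos k)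
    rwa [Real.norm_of_nonneg h1]
  · simp_rw [(key _ (hapos _)).2]
    refine tendsto_integral_of_dominated_convergence (fun z => ‖t z‖)
      (fun k => ?_) hti.norm (fun k => .of_forall fun z => ?_) (.of_forall hlim2)
    · exact AEStronglyMeasurable.mul (by fun_prop : Measurable _).aestronglyMeasurable hti.aestronglyMeasurable.neg
    · rw [norm_mul, norm_neg]
      exact mul_le_of_le_one_left (norm_nonneg _) (damped_score_bound (hapos k)).2.2.2.2

/-- The correlation of the score with a square integrable function whose derivative along `v` is
the constant `c`. -/
theorem integral_mul_score_eq_neg (hφ : Measurable φ)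
    (hs : ∀ z, HasLineDerivAt ℝ φ (s z) z v)
    [IsProbabilityMeasure (ν.withDensity fun z => ENNReal.ofReal (Real.exp (φ z)))]
    (hs2 : MemLp s 2 (ν.withDensity fun z => ENNReal.ofReal (Real.exp (φ z))))
    {e : E → ℝ} {c : ℝ} (he : ∀ z, HasLineDerivAt ℝ e c z v)
    (he2 : MemLp e 2 (ν.withDensity fun z => ENNReal.ofReal (Real.exp (φ z)))) :
    ∫ z, e z * s z ∂(ν.withDensity fun z => ENNReal.ofReal (Real.exp (φ z))) = -c := by
  have hi : Integrable (fun z => e z * s z)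
      (ν.withDensity fun z => ENNReal.ofReal (Real.exp (φ z))) := he2.integrable_mul hs2
  have := integral_lineDeriv_add_mul_score_eq_zero hφ hs he (he2.integrable one_le_two)
    ((integrable_const c).add hi)
  rw [integral_add (integrable_const c) hi] at this
  simp only [integral_const, probReal_univ, one_smul] at this
  linarith

end LineDerivative

/-! ### The law of the trajectory and the measurements -/

section Density

lemma map_withDensity_comp {α β : Type*} [MeasurableSpace α] [MeasurableSpace β]
    {μa : Measure α} {μb : Measure β} {T : α → β} (hT : MeasurePreserving T μa μb)
    {f : β → ENNReal} (hf : Measurable f) :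
    (μa.withDensity (f ∘ T)).map T = μb.withDensity f := by
  ext s hs
  rw [Measure.map_apply hT.measurable hs, withDensity_apply _ (hT.measurable hs),
    withDensity_apply _ hs]
  exact hT.setLIntegral_comp_preimage hs hf

lemma map_eq_withDensity_of_measurePreserving {Ω α β : Type*} [MeasurableSpace Ω]
    [MeasurableSpace α] [MeasurableSpace β] {μ : Measure Ω}
    {μa : Measure α} {μb : Measure β} {T : α → β} (hT : MeasurePreserving T μa μb)
    {ξ : Ω → α} (hξ : Measurable ξ) {f : β → ENNReal} (hf : Measurable f)
    (hlaw : μ.map ξ = μa.withDensity (f ∘ T)) :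
    μ.map (fun ω => T (ξ ω)) = μb.withDensity f := by
  rw [← map_withDensity_comp hT hf, ← hlaw, Measure.map_map hT.measurable hξ]
  rfl

/-- The density of `(ξ, G ξ + V)` for independent `ξ` and `V` with given densities. -/
lemma map_prodMk_add_eq_withDensity {Ω α F : Type*} [MeasurableSpace Ω] [MeasurableSpace α]
    [MeasurableSpace F] [AddCommGroup F] [MeasurableAdd₂ F] [MeasurableSub₂ F]
    {μ : Measure Ω} [IsProbabilityMeasure μ] {μa : Measure α} [SFinite μa]
    {ν : Measure F} [SFinite ν] [ν.IsAddLeftInvariant]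
    {ξ : Ω → α} {V : Ω → F} (hξ : Measurable ξ) (hV : Measurable V) (hind : IndepFun ξ V μ)
    {P : α → ENNReal} {Q : F → ENNReal} (hP : Measurable P) (hQ : Measurable Q)
    (hξl : μ.map ξ = μa.withDensity P) (hVl : μ.map V = ν.withDensity Q)
    {G : α → F} (hG : Measurable G) :
    μ.map (fun ω => (ξ ω, G (ξ ω) + V ω)) =
      (μa.prod ν).withDensity fun z => P z.1 * Q (z.2 - G z.1) := by
  -- The shear `(x, v) ↦ (x, G x + v)` is a translation in each fibre, so it preserves the product
  -- measure and only the density changes.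
  have hT : MeasurePreserving (fun z : α × F => (z.1, G z.1 + z.2)) (μa.prod ν) (μa.prod ν) :=
    (MeasurePreserving.id μa).skew_product (g := fun x y => G x + y)
      ((hG.comp measurable_fst).add measurable_snd)
      (.of_forall fun x => map_add_left_eq_self ν (G x))
  refine map_eq_withDensity_of_measurePreserving hT (hξ.prodMk hV) ?_ ?_
  · exact (hP.comp measurable_fst).mul
      (hQ.comp (measurable_snd.sub (hG.comp measurable_fst)))
  · rw [(indepFun_iff_map_prod_eq_prod_map_map hξ.aemeasurable hV.aemeasurable).1 hind, hξl, hVl,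
      prod_withDensity hP hQ]
    congr 1
    ext z
    simp [Function.comp]

lemma measurePreserving_prod_prod_comm {α β γ δ : Type*} [MeasurableSpace α] [MeasurableSpace β]
    [MeasurableSpace γ] [MeasurableSpace δ] (μa : Measure α) (μb : Measure β) (μc : Measure γ)
    (μd : Measure δ) [SigmaFinite μa] [SigmaFinite μb] [SigmaFinite μc] [SigmaFinite μd] :
    MeasurePreserving (fun z : (α × β) × (γ × δ) => ((z.1.1, z.2.1), (z.1.2, z.2.2)))
      ((μa.prod μb).prod (μc.prod μd)) ((μa.prod μc).prod (μb.prod μd)) := by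
  have h1 := measurePreserving_prodAssoc μa μb (μc.prod μd)
  have h2 : MeasurePreserving (fun z : β × (γ × δ) => (z.2.1, (z.1, z.2.2)))
      (μb.prod (μc.prod μd)) (μc.prod (μb.prod μd)) :=
    ((measurePreserving_prodAssoc μc μb μd).comp
      (Measure.measurePreserving_swap.prod (MeasurePreserving.id μd))).comp
      ((measurePreserving_prodAssoc μb μc μd).symm MeasurableEquiv.prodAssoc)
  exact (((measurePreserving_prodAssoc μa μc (μb.prod μd)).symm MeasurableEquiv.prodAssoc).comp
    ((MeasurePreserving.id μa).prod h2)).comp h1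

lemma measurePreserving_snoc (m : ℕ) (F : Type*) [MeasureSpace F]
    [SigmaFinite (volume : Measure F)] :
    MeasurePreserving (fun z : (Fin m → F) × F => (Fin.snoc z.1 z.2 : Fin (m + 1) → F))
      (volume.prod volume) volume := by
  have hm : Measurable (fun z : (Fin m → F) × F => (Fin.snoc z.1 z.2 : Fin (m + 1) → F)) := by
    refine measurable_pi_iff.2 (Fin.lastCases ?_ fun i => ?_)
    · simp only [Fin.snoc_last]
      fun_prop
    · simp only [Fin.snoc_castSucc]
      fun_prop
  refine ⟨hm, (Measure.pi_eq fun s hs => ?_).symm⟩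
  rw [Measure.map_apply hm (.univ_pi hs)]
  have : (fun z : (Fin m → F) × F => (Fin.snoc z.1 z.2 : Fin (m + 1) → F)) ⁻¹' Set.univ.pi s =
      (Set.univ.pi fun i => s i.castSucc) ×ˢ s (Fin.last m) := by
    ext z
    simp [Fin.forall_fin_succ']
  rw [this, Measure.prod_prod, volume_pi, Measure.pi_pi, Fin.prod_univ_castSucc]

/-- Append a state to a trajectory. -/
def appendState {m n : ℕ} (x : Fin m × Fin n → ℝ) (x' : Fin n → ℝ) : Fin (m + 1) × Fin n → ℝ :=
  fun s => (Fin.snoc (fun i a => x (i, a)) x' : Fin (m + 1) → Fin n → ℝ) s.1 s.2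

@[simp]
lemma appendState_castSucc {m n : ℕ} (x : Fin m × Fin n → ℝ) (x' : Fin n → ℝ) (i : Fin m)
    (a : Fin n) : appendState x x' (i.castSucc, a) = x (i, a) := by
  simp [appendState]

@[simp]
lemma appendState_last {m n : ℕ} (x : Fin m × Fin n → ℝ) (x' : Fin n → ℝ)
    (a : Fin n) : appendState x x' (Fin.last m, a) = x' a := by
  simp [appendState]

lemma measurePreserving_appendState (m n : ℕ) :
    MeasurePreserving (fun z : (Fin m × Fin n → ℝ) × (Fin n → ℝ) => appendState z.1 z.2)
      (volume.prod volume) volume := by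
  have hm : Measurable
      (fun z : (Fin m × Fin n → ℝ) × (Fin n → ℝ) => appendState z.1 z.2) := by
    refine measurable_pi_iff.2 fun s => ?_
    obtain ⟨i, a⟩ := s
    refine Fin.lastCases ?_ (fun i => ?_) i
    · simp only [appendState_last]
      fun_prop
    · simp only [appendState_castSucc]
      fun_prop
  refine ⟨hm, (Measure.pi_eq fun s hs => ?_).symm⟩
  rw [Measure.map_apply hm (.univ_pi hs)]
  have : (fun z : (Fin m × Fin n → ℝ) × (Fin n → ℝ) => appendState z.1 z.2) ⁻¹' Set.univ.pi s =
      (Set.univ.pi fun i : Fin m × Fin n => s (i.1.castSucc, i.2)) ×ˢ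
        Set.univ.pi fun a => s (Fin.last m, a) := by
    ext z
    simp only [Set.mem_preimage, Set.mem_univ_pi, Prod.forall, Fin.forall_fin_succ',
      appendState_castSucc, appendState_last, Set.mem_prod]
  rw [this, Measure.prod_prod, volume_pi, Measure.pi_pi, volume_pi, Measure.pi_pi,
    Fintype.prod_prod_type, Fintype.prod_prod_type, Fin.prod_univ_castSucc]

lemma measurePreserving_history_zero (n p : ℕ) :
    MeasurePreserving (fun x : Fin n → ℝ =>
      ((fun s => x s.2, default) : (Fin 1 × Fin n → ℝ) × (Fin 0 → Fin p → ℝ)))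
      volume (volume.prod volume) := by
  have h1 : MeasurePreserving (fun (x : Fin n → ℝ) (s : Fin 1 × Fin n) => x s.2)
      volume volume := by
    have hm : Measurable (fun (x : Fin n → ℝ) (s : Fin 1 × Fin n) => x s.2) := by fun_prop
    refine ⟨hm, (Measure.pi_eq fun s hs => ?_).symm⟩
    rw [Measure.map_apply hm (.univ_pi hs)]
    have : (fun (x : Fin n → ℝ) (s : Fin 1 × Fin n) => x s.2) ⁻¹' Set.univ.pi s =
        Set.univ.pi fun a => s (0, a) := by
      ext x
      simp [Fin.forall_fin_one]
    rw [this, volume_pi, Measure.pi_pi, Fintype.prod_prod_type]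
    simp
  have hm : Measurable (fun x : Fin n → ℝ =>
      ((fun s => x s.2, default) : (Fin 1 × Fin n → ℝ) × (Fin 0 → Fin p → ℝ))) := by fun_prop
  refine ⟨hm, (Measure.prod_eq fun s t hs ht => ?_).symm⟩
  rw [Measure.map_apply hm (hs.prod ht), ← h1.measure_preimage hs.nullMeasurableSet]
  -- The space of empty measurement sequences is a single point, so `t` is empty or everything.
  rcases t.eq_empty_or_nonempty with rfl | hne
  · simp
  · rw [Subsingleton.eq_univ_of_nonempty hne]
    simp [volume_pi, Set.preimage]

end Density

/-! ### Dependence of the history on the noises, and its joint density. -/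

namespace System

variable {n p : ℕ} {U : Type*} {S : System n p U} {Ω : Type*} {X : ℕ → Ω → Fin n → ℝ} {Y : ℕ → Ω → Fin p → ℝ}
  {W : ℕ → Ω → Fin n → ℝ} {N : ℕ → Ω → Fin p → ℝ}

/-- The trajectory up to time `m` and the measurements before time `m`. -/
def history (X : ℕ → Ω → Fin n → ℝ) (Y : ℕ → Ω → Fin p → ℝ) (m : ℕ) (ω : Ω) :
    (Fin (m + 1) × Fin n → ℝ) × (Fin m → Fin p → ℝ) :=
  (fun s => X s.1 ω s.2, fun j => Y j ω)

lemma history_succ (m : ℕ) (ω : Ω) :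
    history X Y (m + 1) ω = (appendState (history X Y m ω).1 (X (m + 1) ω),
      Fin.snoc (history X Y m ω).2 (Y m ω)) := by
  refine Prod.ext (funext fun s => ?_) (funext fun j => ?_)
  · obtain ⟨i, a⟩ := s
    refine Fin.lastCases ?_ (fun i => ?_) i
    · simp [history]
    · simp [history]
  · refine Fin.lastCases ?_ (fun j => ?_) j
    · simp [history]
    · simp [history]

variable [MeasurableSpace Ω] {μ : Measure Ω}

/-- The noise variables on which the history up to time `m` depends. -/
def pastNoise (m : ℕ) : Set (Unit ⊕ ℕ ⊕ ℕ) :=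
  {i | ∀ j, m ≤ j → i ≠ .inr (.inl j) ∧ i ≠ .inr (.inr j)}

/-- The σ-algebras generated by the initial state and the noise variables. -/
abbrev noiseAlgebra (X : ℕ → Ω → Fin n → ℝ) (W : ℕ → Ω → Fin n → ℝ) (N : ℕ → Ω → Fin p → ℝ) :
    Unit ⊕ ℕ ⊕ ℕ → MeasurableSpace Ω :=
  Sum.elim (fun _ : Unit => MeasurableSpace.comap (X 0) inferInstance)
    (Sum.elim (fun k : ℕ => MeasurableSpace.comap (W k) inferInstance)
      (fun k : ℕ => MeasurableSpace.comap (N k) inferInstance))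

/-- The state at time `k` involves process noise only up to index `k - 1`, so `k = m` is still
allowed. -/
lemma measurable_state_of_le (hS : S.Regular) (h : S.Follows μ X Y W N) {m k : ℕ} (hk : k ≤ m) :
    Measurable[⨆ i ∈ pastNoise m, noiseAlgebra X W N i] (X k) := by
  induction k with
  | zero =>
    have hle : noiseAlgebra X W N (.inl ()) ≤ ⨆ i ∈ pastNoise m, noiseAlgebra X W N i :=
      le_iSup₂_of_le _ (by simp [pastNoise]) le_rfl
    exact Measurable.mono (comap_measurable (X 0)) hle le_rfl
  | succ k ih =>
    have hle : noiseAlgebra X W N (.inr (.inl k)) ≤ ⨆ i ∈ pastNoise m, noiseAlgebra X W N i :=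
      le_iSup₂_of_le _ (by simp [pastNoise]; intros; omega) le_rfl
    have hW : Measurable[⨆ i ∈ pastNoise m, noiseAlgebra X W N i] (W k) :=
      Measurable.mono (comap_measurable (W k)) hle le_rfl
    have := ((hS.measurable_f k).comp (ih (by omega))).add hW
    have heq : X (k + 1) = ((fun x => S.f x (S.u k)) ∘ X k) + W k := funext (h.state_eq k)
    rwa [heq]

/-- The measurement at time `k` involves the noise of the same index, hence the strict inequality.
-/
lemma measurable_meas_of_lt (hS : S.Regular) (h : S.Follows μ X Y W N) {m k : ℕ} (hk : k < m) :
    Measurable[⨆ i ∈ pastNoise m, noiseAlgebra X W N i] (Y k) := by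
  have hle : noiseAlgebra X W N (.inr (.inr k)) ≤ ⨆ i ∈ pastNoise m, noiseAlgebra X W N i :=
    le_iSup₂_of_le _ (by simp [pastNoise]; intros; omega) le_rfl
  have hN : Measurable[⨆ i ∈ pastNoise m, noiseAlgebra X W N i] (N k) :=
    Measurable.mono (comap_measurable (N k)) hle le_rfl
  have := ((hS.measurable_h k).comp (measurable_state_of_le hS h hk.le)).add hN
  have heq : Y k = (S.h k ∘ X k) + N k := funext (h.meas_eq k)
  rwa [heq]

lemma noiseAlgebra_le (h : S.Follows μ X Y W N) (i : Unit ⊕ ℕ ⊕ ℕ) :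
    noiseAlgebra X W N i ≤ ‹MeasurableSpace Ω› := by
  rcases i with i | i | i
  · exact h.measurable_init.comap_le
  · exact (h.measurable_W i).comap_le
  · exact (h.measurable_N i).comap_le

lemma measurable_history_pastNoise (hS : S.Regular) (h : S.Follows μ X Y W N) (m : ℕ) :
    Measurable[⨆ i ∈ pastNoise m, noiseAlgebra X W N i] (history X Y m) := by
  refine Measurable.prodMk ?_ ?_
  · refine @measurable_pi_lambda _ _ _ (_) _ _ fun s => ?_
    exact (measurable_pi_apply s.2).comp (measurable_state_of_le hS h (Nat.le_of_lt_succ s.1.2))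
  · exact @measurable_pi_lambda _ _ _ (_) _ _ fun j => measurable_meas_of_lt hS h j.2

lemma measurable_history (hS : S.Regular) (h : S.Follows μ X Y W N) (m : ℕ) :
    Measurable (history X Y m) :=
  (measurable_history_pastNoise hS h m).mono (iSup₂_le fun i _ => noiseAlgebra_le h i) le_rfl

/-- The history is a function of the variables indexed by `pastNoise m`, a set disjoint from the two
indices of the current noises, and disjoint groups of independent variables are independent. -/
lemma indepFun_history_noise (hS : S.Regular) (h : S.Follows μ X Y W N) (m : ℕ) :
    IndepFun (history X Y m) (fun ω => (W m ω, N m ω)) μ := by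
  have hd : Disjoint (pastNoise m) {.inr (.inl m), .inr (.inr m)} := by
    rw [Set.disjoint_left]
    rintro i hi (rfl | rfl)
    · exact (hi m le_rfl).1 rfl
    · exact (hi m le_rfl).2 rfl
  have hi := indep_iSup_of_disjoint (noiseAlgebra_le h) h.indep hd
  refine indep_of_indep_of_le_left (indep_of_indep_of_le_right hi ?_)
    (measurable_history_pastNoise hS h m).comap_le
  refine Measurable.comap_le (Measurable.prodMk ?_ ?_)
  · exact Measurable.mono (comap_measurable (W m))
      (le_iSup₂_of_le (f := fun i _ => noiseAlgebra X W N i) (.inr (.inl m)) (by simp) le_rfl)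
      le_rfl
  · exact Measurable.mono (comap_measurable (N m))
      (le_iSup₂_of_le (f := fun i _ => noiseAlgebra X W N i) (.inr (.inr m)) (by simp) le_rfl)
      le_rfl

lemma indepFun_noise (h : S.Follows μ X Y W N) (m : ℕ) : IndepFun (W m) (N m) μ :=
  h.indep.indep (i := .inr (.inl m)) (j := .inr (.inr m)) (by simp)

lemma measurable_transDensity (hS : S.Regular) (k : ℕ) :
    Measurable fun z : (Fin n → ℝ) × (Fin n → ℝ) => S.transDensity k z.1 z.2 :=
  (hS.measurable_q k).comp (measurable_snd.sub ((hS.measurable_f k).comp measurable_fst))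

lemma measurable_measDensity (hS : S.Regular) (k : ℕ) :
    Measurable fun z : (Fin n → ℝ) × (Fin p → ℝ) => S.measDensity k z.1 z.2 :=
  (hS.measurable_r k).comp (measurable_snd.sub ((hS.measurable_h k).comp measurable_fst))

lemma measurable_jointDensity (hS : S.Regular) (m : ℕ) :
    Measurable fun z : (Fin (m + 1) × Fin n → ℝ) × (Fin m → Fin p → ℝ) =>
      S.jointDensity m z.1 z.2 := by
  refine ((hS.measurable_prior.comp (by fun_prop)).mul
    (Finset.measurable_prod _ fun i _ => ?_)).mul (Finset.measurable_prod _ fun i _ => ?_)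
  · exact (measurable_transDensity hS i).comp
      (f := fun z : (Fin (m + 1) × Fin n → ℝ) × (Fin m → Fin p → ℝ) =>
        ((fun a => z.1 (i.castSucc, a), fun a => z.1 (i.succ, a)) : _ × _)) (by fun_prop)
  · exact (measurable_measDensity hS i).comp
      (f := fun z : (Fin (m + 1) × Fin n → ℝ) × (Fin m → Fin p → ℝ) =>
        ((fun a => z.1 (i.castSucc, a), z.2 i) : _ × _)) (by fun_prop)

lemma jointDensity_pos (hS : S.Regular) (m : ℕ) (x : Fin (m + 1) × Fin n → ℝ)
    (y : Fin m → Fin p → ℝ) : 0 < S.jointDensity m x y :=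
  mul_pos (mul_pos (hS.prior_pos _) (Finset.prod_pos fun _ _ => hS.q_pos _ _))
    (Finset.prod_pos fun _ _ => hS.r_pos _ _)

lemma jointDensity_succ (m : ℕ) (x : Fin (m + 2) × Fin n → ℝ) (y : Fin (m + 1) → Fin p → ℝ) :
    S.jointDensity (m + 1) x y =
      S.jointDensity m (fun s => x (s.1.castSucc, s.2)) (fun j => y j.castSucc) *
        (S.transDensity m (fun a => x ((Fin.last m).castSucc, a))
            (fun a => x (Fin.last (m + 1), a)) *
          S.measDensity m (fun a => x ((Fin.last m).castSucc, a)) (y (Fin.last m))) := by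
  simp only [jointDensity, Fin.prod_univ_castSucc (n := m), Fin.val_castSucc, Fin.val_last,
    Fin.castSucc_zero, Fin.succ_castSucc, Fin.succ_last]
  ring

variable [IsProbabilityMeasure μ]

/-- The joint density of the trajectory up to time `m` and the measurements before time `m`. -/
theorem map_history (hS : S.Regular) (h : S.Follows μ X Y W N) (m : ℕ) :
    μ.map (history X Y m) = (volume.prod volume).withDensity fun z =>
      ENNReal.ofReal (S.jointDensity m z.1 z.2) := by
  induction m with
  | zero =>
    have hlaw := map_eq_withDensity_of_measurePreserving (measurePreserving_history_zero n p)
      h.measurable_init (measurable_jointDensity hS 0).ennreal_ofReal (μ := μ) ?_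
    · rw [← hlaw]
      congr 1
      ext1 ω
      refine Prod.ext (funext fun s => ?_) (Subsingleton.elim _ _)
      simp [history]
    · rw [h.law_init]
      congr 1
      ext1 x
      simp [jointDensity]
  | succ m ih =>
    have hV : μ.map (fun ω => (W m ω, N m ω)) = (volume.prod volume).withDensity fun z =>
        ENNReal.ofReal (S.q m z.1) * ENNReal.ofReal (S.r m z.2) := by
      rw [(indepFun_iff_map_prod_eq_prod_map_map (h.measurable_W m).aemeasurable
        (h.measurable_N m).aemeasurable).1 (indepFun_noise h m), h.law_W, h.law_N,
        prod_withDensity (hS.measurable_q m).ennreal_ofReal (hS.measurable_r m).ennreal_ofReal]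
    have hG : Measurable fun z : (Fin (m + 1) × Fin n → ℝ) × (Fin m → Fin p → ℝ) =>
        (S.f (fun a => z.1 (Fin.last m, a)) (S.u m), S.h m (fun a => z.1 (Fin.last m, a))) :=
      ((hS.measurable_f m).comp (by fun_prop)).prodMk ((hS.measurable_h m).comp (by fun_prop))
    -- The new state and the new measurement are treated as one vector: a function of the history
    -- plus the independent pair of current noises.
    have hlaw := map_prodMk_add_eq_withDensity (measurable_history hS h m)
      ((h.measurable_W m).prodMk (h.measurable_N m)) (indepFun_history_noise hS h m)
      (measurable_jointDensity hS m).ennreal_ofReal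
      (((hS.measurable_q m).comp measurable_fst).ennreal_ofReal.mul
        ((hS.measurable_r m).comp measurable_snd).ennreal_ofReal) ih hV hG
    -- Regrouping: the new state joins the trajectory and the new measurement joins the
    -- measurements, without changing Lebesgue measure.
    have hT := ((measurePreserving_appendState (m + 1) n).prod
      (measurePreserving_snoc m (Fin p → ℝ))).comp
      (measurePreserving_prod_prod_comm (volume : Measure (Fin (m + 1) × Fin n → ℝ))
        (volume : Measure (Fin m → Fin p → ℝ)) (volume : Measure (Fin n → ℝ))
        (volume : Measure (Fin p → ℝ)))
    have := map_eq_withDensity_of_measurePreserving hT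
      ((measurable_history hS h m).prodMk ((hG.comp (measurable_history hS h m)).add
        ((h.measurable_W m).prodMk (h.measurable_N m))))
      (measurable_jointDensity hS (m + 1)).ennreal_ofReal (hlaw.trans ?_)
    · rw [← this]
      congr 1
      ext1 ω
      rw [history_succ, h.state_eq, h.meas_eq]
      rfl
    · congr 1
      ext1 z
      simp only [Function.comp_apply, jointDensity_succ, appendState_castSucc, appendState_last,
        Fin.snoc_castSucc, Fin.snoc_last, Prod.map]
      rw [ENNReal.ofReal_mul (jointDensity_pos hS _ _ _).le]
      exact congrArg _ (ENNReal.ofReal_mul (hS.q_pos _ _).le).symm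

end System

/-! ### Second derivatives -/

section SecondDerivative

variable {E F : Type*} [NormedAddCommGroup E] [NormedSpace ℝ E]
  [NormedAddCommGroup F] [NormedSpace ℝ F]

lemma TwiceDifferentiable.add {φ ψ : E → ℝ} (hφ : TwiceDifferentiable φ)
    (hψ : TwiceDifferentiable ψ) : TwiceDifferentiable fun x => φ x + ψ x := by
  refine ⟨hφ.1.add hψ.1, ?_⟩
  have : fderiv ℝ (fun x => φ x + ψ x) = fun x => fderiv ℝ φ x + fderiv ℝ ψ x :=
    funext fun x => fderiv_fun_add (hφ.1 x) (hψ.1 x)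
  rw [this]
  exact hφ.2.add hψ.2

lemma fderiv_fderiv_add {φ ψ : E → ℝ} (hφ : TwiceDifferentiable φ)
    (hψ : TwiceDifferentiable ψ) (x : E) :
    fderiv ℝ (fderiv ℝ fun x => φ x + ψ x) x =
      fderiv ℝ (fderiv ℝ φ) x + fderiv ℝ (fderiv ℝ ψ) x := by
  have : fderiv ℝ (fun x => φ x + ψ x) = fun x => fderiv ℝ φ x + fderiv ℝ ψ x :=
    funext fun x => fderiv_fun_add (hφ.1 x) (hψ.1 x)
  rw [this]
  exact fderiv_fun_add (hφ.2 x) (hψ.2 x)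

lemma hasFDerivAt_comp_affine {φ : F → ℝ} (hφ : TwiceDifferentiable φ) (L : E →L[ℝ] F) (c : F)
    (x : E) : HasFDerivAt (fun x => φ (L x + c)) ((fderiv ℝ φ (L x + c)).comp L) x :=
  (hφ.1 _).hasFDerivAt.comp x (L.hasFDerivAt.add_const c)

lemma hasFDerivAt_fderiv_comp_affine {φ : F → ℝ} (hφ : TwiceDifferentiable φ) (L : E →L[ℝ] F)
    (c : F) (x : E) : HasFDerivAt (fderiv ℝ fun x => φ (L x + c))
      (((ContinuousLinearMap.compL ℝ E F ℝ).flip L).comp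
        ((fderiv ℝ (fderiv ℝ φ) (L x + c)).comp L)) x := by
  have : fderiv ℝ (fun x => φ (L x + c)) =
      fun x => (ContinuousLinearMap.compL ℝ E F ℝ).flip L (fderiv ℝ φ (L x + c)) :=
    funext fun x => (hasFDerivAt_comp_affine hφ L c x).fderiv
  rw [this]
  exact ((ContinuousLinearMap.compL ℝ E F ℝ).flip L).hasFDerivAt.comp x
    ((hφ.2 _).hasFDerivAt.comp x (L.hasFDerivAt.add_const c))

lemma TwiceDifferentiable.comp_affine {φ : F → ℝ} (hφ : TwiceDifferentiable φ) (L : E →L[ℝ] F)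
    (c : F) : TwiceDifferentiable fun x => φ (L x + c) :=
  ⟨fun x => (hasFDerivAt_comp_affine hφ L c x).differentiableAt,
    fun x => (hasFDerivAt_fderiv_comp_affine hφ L c x).differentiableAt⟩

lemma TwiceDifferentiable.comp_linear {φ : F → ℝ} (hφ : TwiceDifferentiable φ) (L : E →L[ℝ] F) :
    TwiceDifferentiable fun x => φ (L x) := by
  simpa using hφ.comp_affine L 0

/-- An affine inner map has no second derivative, so the chain rule has no further term. The
constant `c` serves to freeze one of two variables. -/
lemma fderiv_fderiv_comp_affine {φ : F → ℝ} (hφ : TwiceDifferentiable φ) (L : E →L[ℝ] F)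
    (c : F) (x u v : E) : fderiv ℝ (fderiv ℝ fun x => φ (L x + c)) x u v =
      fderiv ℝ (fderiv ℝ φ) (L x + c) (L u) (L v) := by
  rw [(hasFDerivAt_fderiv_comp_affine hφ L c x).fderiv]
  rfl

lemma fderiv_fderiv_comp_linear {φ : F → ℝ} (hφ : TwiceDifferentiable φ) (L : E →L[ℝ] F)
    (x u v : E) : fderiv ℝ (fderiv ℝ fun x => φ (L x)) x u v =
      fderiv ℝ (fderiv ℝ φ) (L x) (L u) (L v) := by
  simpa using fderiv_fderiv_comp_affine hφ L 0 x u v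

lemma TwiceDifferentiable.hasFDerivAt_fderiv_apply {φ : E → ℝ} (hφ : TwiceDifferentiable φ)
    (x v : E) : HasFDerivAt (fun x => fderiv ℝ φ x v) ((fderiv ℝ (fderiv ℝ φ) x).flip v) x := by
  simpa using (hφ.2 x).hasFDerivAt.clm_apply (hasFDerivAt_const v x)

variable {κ : Type*} [Fintype κ] [DecidableEq κ]

lemma hessian_apply {φ : (κ → ℝ) → ℝ} (hφ : TwiceDifferentiable φ) (x : κ → ℝ) (a b : κ) :
    hessian φ x a b =
      fderiv ℝ (fderiv ℝ φ) x (Pi.single a 1) (Pi.single b 1) := by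
  simp only [hessian, partialDeriv, Matrix.of_apply]
  rw [(hφ.hasFDerivAt_fderiv_apply x _).fderiv]
  rfl

/-- Symmetry needs only that the derivative is itself differentiable at the point; second
derivatives need not be continuous. -/
lemma hessian_symm {φ : (κ → ℝ) → ℝ} (hφ : TwiceDifferentiable φ) (x : κ → ℝ) (a b : κ) :
    hessian φ x a b = hessian φ x b a := by
  rw [hessian_apply hφ, hessian_apply hφ]
  exact second_derivative_symmetric (fun y => (hφ.1 y).hasFDerivAt) (hφ.2 x).hasFDerivAt _ _

open Matrix in
lemma dotProduct_hessian_mulVec {φ : (κ → ℝ) → ℝ} (hφ : TwiceDifferentiable φ) (x u v : κ → ℝ) :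
    u ⬝ᵥ hessian φ x *ᵥ v = fderiv ℝ (fderiv ℝ φ) x u v := by
  have hu : ∀ u : κ → ℝ, u = ∑ a, u a • (Pi.single a 1 : κ → ℝ) := fun u => by
    simpa using (pi_eq_sum_univ' u)
  conv_rhs => rw [hu u, hu v]
  simp only [dotProduct, mulVec, hessian_apply hφ, map_sum, map_smul,
    _root_.sum_apply, _root_.smul_apply, smul_eq_mul]
  simp only [Finset.mul_sum]
  refine Eq.trans ?_ Finset.sum_comm
  refine Finset.sum_congr rfl fun a _ => Finset.sum_congr rfl fun b _ => ?_
  ring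

lemma hessian_fst_slice {T : (κ → ℝ) × (κ → ℝ) → ℝ} (hT : TwiceDifferentiable T) (x x' : κ → ℝ)
    (a b : κ) : hessian (fun z => T (z, x')) x a b =
      fderiv ℝ (fderiv ℝ T) (x, x') (Pi.single a 1, 0) (Pi.single b 1, 0) := by
  have h := hT.comp_affine (.inl ℝ (κ → ℝ) (κ → ℝ)) (0, x')
  have h' := fderiv_fderiv_comp_affine hT (.inl ℝ (κ → ℝ) (κ → ℝ)) (0, x') x
    (Pi.single a 1) (Pi.single b 1)
  simp only [ContinuousLinearMap.inl_apply, Prod.mk_add_mk, add_zero, zero_add] at h h'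
  rw [hessian_apply h, h']

lemma hessian_snd_slice {T : (κ → ℝ) × (κ → ℝ) → ℝ} (hT : TwiceDifferentiable T) (x x' : κ → ℝ)
    (a b : κ) : hessian (fun z => T (x, z)) x' a b =
      fderiv ℝ (fderiv ℝ T) (x, x') (0, Pi.single a 1) (0, Pi.single b 1) := by
  have h := hT.comp_affine (.inr ℝ (κ → ℝ) (κ → ℝ)) (x, 0)
  have h' := fderiv_fderiv_comp_affine hT (.inr ℝ (κ → ℝ) (κ → ℝ)) (x, 0) x'
    (Pi.single a 1) (Pi.single b 1)
  simp only [ContinuousLinearMap.inr_apply, Prod.mk_add_mk, add_zero, zero_add] at h h'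
  rw [hessian_apply h, h']

lemma mixedHessian_apply {T : (κ → ℝ) × (κ → ℝ) → ℝ} (hT : TwiceDifferentiable T)
    (x x' : κ → ℝ) (a b : κ) : mixedHessian (fun z z' => T (z, z')) x x' a b =
      fderiv ℝ (fderiv ℝ T) (x, x') (Pi.single a 1, 0) (0, Pi.single b 1) := by
  have h1 : ∀ z, fderiv ℝ (fun z' => T (z, z')) x' (Pi.single b 1) =
      fderiv ℝ T (z, x') (0, Pi.single b 1) := fun z => by
    have h := (hasFDerivAt_comp_affine hT (.inr ℝ (κ → ℝ) (κ → ℝ)) (z, 0) x').fderiv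
    simp only [ContinuousLinearMap.inr_apply, Prod.mk_add_mk, add_zero, zero_add] at h
    rw [h]
    rfl
  simp only [mixedHessian, partialDeriv, Matrix.of_apply, h1]
  have h2 := (hT.hasFDerivAt_fderiv_apply (x, x') (0, Pi.single b 1)).comp
    (f := fun z => (z, x')) x (hasFDerivAt_prodMk_left x x')
  have h3 : HasFDerivAt (fun z => fderiv ℝ T (z, x') (0, Pi.single b 1)) _ x := h2
  rw [h3.fderiv]
  rfl

end SecondDerivative

/-! ### The information matrix of the trajectory -/

/-- The state at time `i`, as a function of the trajectory. -/
def stateAt {m n : ℕ} (i : Fin m) : (Fin m × Fin n → ℝ) →L[ℝ] (Fin n → ℝ) :=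
  .pi fun a => .proj (i, a)

/-- The trajectory without the final state. -/
def dropLast {m n : ℕ} : (Fin (m + 1) × Fin n → ℝ) →L[ℝ] (Fin m × Fin n → ℝ) :=
  .pi fun s => .proj (s.1.castSucc, s.2)

lemma stateAt_apply {m n : ℕ} (i : Fin m) (x : Fin m × Fin n → ℝ) :
    stateAt i x = fun a => x (i, a) := rfl

lemma dropLast_apply {m n : ℕ} (x : Fin (m + 1) × Fin n → ℝ) :
    dropLast x = fun s => x (s.1.castSucc, s.2) := rfl

lemma stateAt_single {m n : ℕ} (i : Fin m) (a : Fin n) :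
    stateAt i (Pi.single (i, a) 1) = Pi.single a (1 : ℝ) := by
  ext b
  simp [stateAt_apply, Pi.single_apply]

lemma stateAt_single_of_ne {m n : ℕ} {i j : Fin m} (hij : i ≠ j) (a : Fin n) :
    stateAt i (Pi.single (j, a) (1 : ℝ)) = 0 := by
  ext b
  simp [stateAt_apply, hij]

lemma dropLast_single_castSucc {m n : ℕ} (i : Fin m) (a : Fin n) :
    dropLast (Pi.single (i.castSucc, a) 1) = Pi.single (i, a) (1 : ℝ) := by
  ext b
  simp [dropLast_apply, Pi.single_apply, Prod.ext_iff]

lemma dropLast_single_last {m n : ℕ} (a : Fin n) :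
    dropLast (Pi.single (Fin.last m, a) (1 : ℝ)) = 0 := by
  ext b
  simp [dropLast_apply, Prod.ext_iff]

namespace System

variable {n p : ℕ} {U : Type*} {S : System n p U}

/-- The Markov structure in additive form. Each summand is a function composed with a continuous
linear map of the trajectory, ready for the second-order chain rule. -/
lemma log_jointDensity_succ (hS : S.Regular) (m : ℕ) (x : Fin (m + 2) × Fin n → ℝ)
    (y : Fin (m + 1) → Fin p → ℝ) :
    Real.log (S.jointDensity (m + 1) x y) =
      Real.log (S.jointDensity m (dropLast x) fun j => y j.castSucc) +
        ((fun z : (Fin n → ℝ) × (Fin n → ℝ) => Real.log (S.transDensity m z.1 z.2))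
          (((stateAt (Fin.last m).castSucc).prod (stateAt (Fin.last (m + 1)))) x) +
        Real.log (S.measDensity m (stateAt (Fin.last m).castSucc x) (y (Fin.last m)))) := by
  have h1 : ∀ x x', S.transDensity m x x' ≠ 0 := fun x x' => (hS.q_pos m _).ne'
  have h2 : ∀ x y, S.measDensity m x y ≠ 0 := fun x y => (hS.r_pos m _).ne'
  rw [jointDensity_succ, Real.log_mul (jointDensity_pos hS _ _ _).ne'
    (mul_ne_zero (h1 _ _) (h2 _ _)), Real.log_mul (h1 _ _) (h2 _ _)]
  rfl

lemma log_jointDensity_zero (x : Fin (0 + 1) × Fin n → ℝ) (y : Fin 0 → Fin p → ℝ) :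
    Real.log (S.jointDensity 0 x y) = Real.log (S.prior (stateAt 0 x)) := by
  simp [jointDensity, stateAt_apply]

lemma twiceDifferentiable_log_jointDensity (hS : S.Regular) (m : ℕ) (y : Fin m → Fin p → ℝ) :
    TwiceDifferentiable fun x => Real.log (S.jointDensity m x y) := by
  induction m with
  | zero =>
    simp only [log_jointDensity_zero]
    exact hS.diff_prior.comp_linear _
  | succ m ih =>
    simp only [log_jointDensity_succ hS]
    exact ((ih _).comp_linear dropLast).add
      (((hS.diff_trans m).comp_linear _).add ((hS.diff_meas m _).comp_linear _))

lemma hessian_log_jointDensity_succ (hS : S.Regular) (m : ℕ) (x : Fin (m + 2) × Fin n → ℝ)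
    (y : Fin (m + 1) → Fin p → ℝ) (s t : Fin (m + 2) × Fin n) :
    hessian (fun x => Real.log (S.jointDensity (m + 1) x y)) x s t =
      fderiv ℝ (fderiv ℝ fun x => Real.log (S.jointDensity m x fun j => y j.castSucc)) (dropLast x)
        (dropLast (Pi.single s 1)) (dropLast (Pi.single t 1)) +
      (fderiv ℝ (fderiv ℝ fun z : (Fin n → ℝ) × (Fin n → ℝ) =>
          Real.log (S.transDensity m z.1 z.2))
        (stateAt (Fin.last m).castSucc x, stateAt (Fin.last (m + 1)) x)
        (stateAt (Fin.last m).castSucc (Pi.single s 1), stateAt (Fin.last (m + 1)) (Pi.single s 1))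
        (stateAt (Fin.last m).castSucc (Pi.single t 1),
          stateAt (Fin.last (m + 1)) (Pi.single t 1)) +
      fderiv ℝ (fderiv ℝ fun x => Real.log (S.measDensity m x (y (Fin.last m))))
        (stateAt (Fin.last m).castSucc x) (stateAt (Fin.last m).castSucc (Pi.single s 1))
        (stateAt (Fin.last m).castSucc (Pi.single t 1))) := by
  rw [hessian_apply (twiceDifferentiable_log_jointDensity hS _ _)]
  simp only [log_jointDensity_succ hS]
  have h1 := twiceDifferentiable_log_jointDensity hS m fun j => y j.castSucc
  have h2 := hS.diff_trans m
  have h3 := hS.diff_meas m (y (Fin.last m))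
  rw [fderiv_fderiv_add (h1.comp_linear dropLast) ((h2.comp_linear _).add (h3.comp_linear _)),
    fderiv_fderiv_add (h2.comp_linear _) (h3.comp_linear _)]
  simp only [_root_.add_apply]
  rw [fderiv_fderiv_comp_linear h1, fderiv_fderiv_comp_linear h2, fderiv_fderiv_comp_linear h3]
  rfl

variable {Ω : Type*} {X : ℕ → Ω → Fin n → ℝ} {Y : ℕ → Ω → Fin p → ℝ}

/-- The negative Hessian of the logarithm of the joint density, along the process. -/
def trajHess (S : System n p U) (X : ℕ → Ω → Fin n → ℝ) (Y : ℕ → Ω → Fin p → ℝ) (m : ℕ) (ω : Ω) :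
    Matrix (Fin (m + 1) × Fin n) (Fin (m + 1) × Fin n) ℝ :=
  -hessian (fun x => Real.log (S.jointDensity m x fun j => Y j ω)) (fun s => X s.1 ω s.2)

lemma trajHess_symm (hS : S.Regular) (m : ℕ) (ω : Ω) (s t : Fin (m + 1) × Fin n) :
    S.trajHess X Y m ω s t = S.trajHess X Y m ω t s := by
  simp only [trajHess, Matrix.neg_apply]
  rw [hessian_symm (twiceDifferentiable_log_jointDensity hS _ _)]

lemma trajHess_zero (hS : S.Regular) (ω : Ω) (i j : Fin (0 + 1)) (a b : Fin n) :
    S.trajHess X Y 0 ω (i, a) (j, b) = S.priorHess X ω a b := by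
  obtain rfl : i = 0 := Subsingleton.elim (α := Fin 1) _ _
  obtain rfl : j = 0 := Subsingleton.elim (α := Fin 1) _ _
  simp only [trajHess, priorHess, Matrix.neg_apply, log_jointDensity_zero]
  rw [hessian_apply (hS.diff_prior.comp_linear _), hessian_apply hS.diff_prior,
    fderiv_fderiv_comp_linear hS.diff_prior, stateAt_single, stateAt_single]
  rfl

/-- The two new factors see the old trajectory only through its last state, so they change nothing
outside the last diagonal block. The same reason makes the off-diagonal block below vanish except in
its last row. -/
lemma trajHess_castSucc_castSucc (hS : S.Regular) (m : ℕ) (ω : Ω) (i j : Fin (m + 1))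
    (a b : Fin n) :
    S.trajHess X Y (m + 1) ω (i.castSucc, a) (j.castSucc, b) =
      S.trajHess X Y m ω (i, a) (j, b) +
        if i = Fin.last m ∧ j = Fin.last m then S.hess11 X Y m ω a b else 0 := by
  have hne : ∀ i : Fin (m + 1), Fin.last (m + 1) ≠ i.castSucc := fun i => (Fin.castSucc_lt_last i).ne'
  have hne' : ∀ i : Fin (m + 1), i ≠ Fin.last m → (Fin.last m).castSucc ≠ i.castSucc :=
    fun i hi h => hi (Fin.castSucc_injective _ h).symm
  simp only [trajHess, Matrix.neg_apply]
  rw [hessian_log_jointDensity_succ hS, dropLast_single_castSucc, dropLast_single_castSucc,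
    ← hessian_apply (twiceDifferentiable_log_jointDensity hS _ _),
    stateAt_single_of_ne (hne i), stateAt_single_of_ne (hne j)]
  by_cases hi : i = Fin.last m
  · by_cases hj : j = Fin.last m
    · subst hi hj
      rw [if_pos ⟨rfl, rfl⟩]
      rw [stateAt_single, stateAt_single, ← hessian_fst_slice (hS.diff_trans m),
        ← hessian_apply (hS.diff_meas m _)]
      simp only [hess11, Matrix.sub_apply, Matrix.neg_apply, dropLast_apply, stateAt_apply,
        Fin.val_castSucc, Fin.val_last]
      ring
    · rw [if_neg (by tauto), stateAt_single_of_ne (hne' j hj), Prod.mk_zero_zero]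
      simp [dropLast_apply]
  · rw [if_neg (by tauto), stateAt_single_of_ne (hne' i hi), Prod.mk_zero_zero]
    simp [dropLast_apply]

lemma trajHess_castSucc_last (hS : S.Regular) (m : ℕ) (ω : Ω) (i : Fin (m + 1))
    (a b : Fin n) :
    S.trajHess X Y (m + 1) ω (i.castSucc, a) (Fin.last (m + 1), b) =
      if i = Fin.last m then S.hess12 X m ω a b else 0 := by
  have hne : ∀ i : Fin (m + 1), Fin.last (m + 1) ≠ i.castSucc := fun i => (Fin.castSucc_lt_last i).ne'
  simp only [trajHess, Matrix.neg_apply]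
  rw [hessian_log_jointDensity_succ hS, dropLast_single_last, stateAt_single_of_ne (hne i),
    stateAt_single_of_ne (hne _).symm, stateAt_single]
  by_cases hi : i = Fin.last m
  · subst hi
    rw [if_pos rfl, stateAt_single, ← mixedHessian_apply (hS.diff_trans m)]
    simp [hess12, stateAt_apply]
  · rw [if_neg hi, stateAt_single_of_ne fun h => hi (Fin.castSucc_injective _ h).symm,
      Prod.mk_zero_zero]
    simp

lemma trajHess_last_last (hS : S.Regular) (m : ℕ) (ω : Ω) (a b : Fin n) :
    S.trajHess X Y (m + 1) ω (Fin.last (m + 1), a) (Fin.last (m + 1), b) =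
      S.hess22 X m ω a b := by
  have hne : ∀ i : Fin (m + 1), i.castSucc ≠ Fin.last (m + 1) := fun i => (Fin.castSucc_lt_last i).ne
  simp only [trajHess, Matrix.neg_apply]
  rw [hessian_log_jointDensity_succ hS, dropLast_single_last, dropLast_single_last,
    stateAt_single_of_ne (hne _), stateAt_single_of_ne (hne _), stateAt_single, stateAt_single,
    ← hessian_snd_slice (hS.diff_trans m)]
  simp [hess22, stateAt_apply]

variable [MeasurableSpace Ω] {μ : Measure Ω}

/-- Every entry is a finite sum of entries of the prior Hessian and of the `D` blocks, so no
separate integrability assumption on the trajectory is needed. -/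
lemma hasExpectation_trajHess (hS : S.Regular) (hprior : HasExpectation μ (S.priorHess X)) (m : ℕ)
    (hD : ∀ j < m, HasExpectation μ (S.hess11 X Y j) ∧ HasExpectation μ (S.hess12 X j) ∧
      HasExpectation μ (S.hess22 X j)) : HasExpectation μ (S.trajHess X Y m) := by
  induction m with
  | zero =>
    rintro ⟨i, a⟩ ⟨j, b⟩
    simpa only [trajHess_zero hS] using hprior a b
  | succ m ih =>
    obtain ⟨h11, h12, h22⟩ := hD m m.lt_succ_self
    have hc : ∀ (i : Fin (m + 1)) (a b : Fin n), Integrable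
        (fun ω => S.trajHess X Y (m + 1) ω (i.castSucc, a) (Fin.last (m + 1), b)) μ :=
      fun i a b => by
        simp only [trajHess_castSucc_last hS]
        split_ifs
        · exact h12 a b
        · exact integrable_zero _ _ _
    rintro ⟨i, a⟩ ⟨j, b⟩
    refine Fin.lastCases ?_ (fun i => ?_) i <;> refine Fin.lastCases ?_ (fun j => ?_) j
    · simpa only [trajHess_last_last hS] using h22 a b
    · simpa only [trajHess_symm hS _ _ (Fin.last (m + 1), a)] using hc j b a
    · exact hc i a b
    · simp only [trajHess_castSucc_castSucc hS]
      refine (ih (fun j hj => hD j (hj.trans m.lt_succ_self)) _ _).add ?_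
      split_ifs
      · exact h11 a b
      · exact integrable_zero _ _ _

lemma infoMatrix_apply (m : ℕ) (s t : Fin (m + 1) × Fin n) :
    S.infoMatrix μ X Y m s t = ∫ ω, S.trajHess X Y m ω s t ∂μ := rfl

lemma infoMatrix_symm (hS : S.Regular) (m : ℕ) (s t : Fin (m + 1) × Fin n) :
    S.infoMatrix μ X Y m s t = S.infoMatrix μ X Y m t s := by
  simp only [infoMatrix_apply, trajHess_symm hS _ _ s t]

lemma infoMatrix_castSucc_castSucc (hS : S.Regular) {m : ℕ}
    (hm : HasExpectation μ (S.trajHess X Y m)) (h11 : HasExpectation μ (S.hess11 X Y m))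
    (i j : Fin (m + 1)) (a b : Fin n) :
    S.infoMatrix μ X Y (m + 1) (i.castSucc, a) (j.castSucc, b) =
      S.infoMatrix μ X Y m (i, a) (j, b) +
        if i = Fin.last m ∧ j = Fin.last m then S.D11 μ X Y m a b else 0 := by
  simp only [infoMatrix_apply, trajHess_castSucc_castSucc hS]
  split_ifs
  · exact integral_add (hm _ _) (h11 _ _)
  · simp

lemma infoMatrix_castSucc_last (hS : S.Regular) (m : ℕ) (i : Fin (m + 1)) (a b : Fin n) :
    S.infoMatrix μ X Y (m + 1) (i.castSucc, a) (Fin.last (m + 1), b) =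
      if i = Fin.last m then S.D12 μ X m a b else 0 := by
  simp only [infoMatrix_apply, trajHess_castSucc_last hS]
  split_ifs
  · rfl
  · simp

lemma blockC_succ (hS : S.Regular) (m : ℕ) : S.blockC μ X Y (m + 1) = S.D22 μ X m := by
  ext a b
  simp only [blockC, Matrix.of_apply, infoMatrix_apply, trajHess_last_last hS]
  rfl

/-- At time 0 the blocks `A` and `B` are empty, so the Schur correction is an empty sum. -/
lemma predInfo_zero (hS : S.Regular) :
    S.predInfo μ X Y 0 = expectation μ (S.priorHess X) := by
  ext a b
  simp [predInfo, Matrix.mul_apply, blockC, infoMatrix_apply, trajHess_zero hS, expectation]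

end System

/-! ### Splitting off the final state, and quadratic forms of expected matrices. -/

open Matrix

instance isAddHaarMeasure_volume_history (m n p : ℕ) :
    (volume : Measure ((Fin (m + 1) × Fin n → ℝ) × (Fin m → Fin p → ℝ))).IsAddHaarMeasure := by
  have : (volume : Measure (Fin m → Fin p → ℝ)).IsAddHaarMeasure :=
    Measure.pi.isAddHaarMeasure fun _ : Fin m => (volume : Measure (Fin p → ℝ))
  exact Measure.prod.instIsAddHaarMeasure (volume : Measure (Fin (m + 1) × Fin n → ℝ))
    (volume : Measure (Fin m → Fin p → ℝ))

lemma dotProduct_eq_sum_castSucc_add_last {m n : ℕ} (x y : Fin (m + 1) × Fin n → ℝ) :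
    x ⬝ᵥ y = dropLast x ⬝ᵥ dropLast y + stateAt (Fin.last m) x ⬝ᵥ stateAt (Fin.last m) y := by
  simp only [dotProduct, Fintype.sum_prod_type, Fin.sum_univ_castSucc (n := m), dropLast_apply,
    stateAt_apply]

@[simp]
lemma dropLast_appendState {m n : ℕ} (x : Fin m × Fin n → ℝ) (x' : Fin n → ℝ) :
    dropLast (appendState x x') = x := by
  ext s
  simp [dropLast_apply]

@[simp]
lemma stateAt_last_appendState {m n : ℕ} (x : Fin m × Fin n → ℝ) (x' : Fin n → ℝ) :
    stateAt (Fin.last m) (appendState x x') = x' := by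
  ext s
  simp [stateAt_apply]

/-- The quadratic form `aᵀ E[e eᵀ] a` as an expectation. -/
lemma dotProduct_expectation_mulVec {Ω κ : Type*} [MeasurableSpace Ω] [Fintype κ] {μ : Measure Ω}
    {M : Ω → Matrix κ κ ℝ} (hM : HasExpectation μ M) (u : κ → ℝ) :
    Integrable (fun ω => u ⬝ᵥ M ω *ᵥ u) μ ∧
      ∫ ω, u ⬝ᵥ M ω *ᵥ u ∂μ = u ⬝ᵥ expectation μ M *ᵥ u := by
  have h1 : ∀ a b, Integrable (fun ω => u a * (M ω a b * u b)) μ := fun a b =>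
    ((hM a b).mul_const _).const_mul _
  have h2 : ∀ a, Integrable (fun ω => ∑ b, u a * (M ω a b * u b)) μ := fun a =>
    integrable_finsetSum _ fun b _ => h1 a b
  simp only [dotProduct, mulVec, Finset.mul_sum, expectation, Matrix.of_apply]
  refine ⟨integrable_finsetSum _ fun a _ => h2 a, ?_⟩
  rw [integral_finsetSum _ fun a _ => h2 a]
  refine Finset.sum_congr rfl fun a _ => ?_
  rw [integral_finsetSum _ fun b _ => h1 a b]
  refine Finset.sum_congr rfl fun b _ => ?_
  rw [integral_const_mul, integral_mul_const]

namespace System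

variable {n p : ℕ} {U : Type*} {S : System n p U} {Ω : Type*}
  {X : ℕ → Ω → Fin n → ℝ} {Y : ℕ → Ω → Fin p → ℝ}
  {W : ℕ → Ω → Fin n → ℝ} {N : ℕ → Ω → Fin p → ℝ}

/-! ### The score of the joint density -/

/-- The logarithm of the joint density of trajectory and measurements. -/
def logDensity (S : System n p U) (m : ℕ)
    (z : (Fin (m + 1) × Fin n → ℝ) × (Fin m → Fin p → ℝ)) : ℝ :=
  Real.log (S.jointDensity m z.1 z.2)

/-- The derivative of the logarithm of the joint density along the direction `v` of the
trajectory. -/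
def score (S : System n p U) (m : ℕ) (v : Fin (m + 1) × Fin n → ℝ)
    (z : (Fin (m + 1) × Fin n → ℝ) × (Fin m → Fin p → ℝ)) : ℝ :=
  fderiv ℝ (fun x => Real.log (S.jointDensity m x z.2)) z.1 v

/-- The second derivative of the logarithm of the joint density along the direction `v` of the
trajectory. -/
def scoreDeriv (S : System n p U) (m : ℕ) (v : Fin (m + 1) × Fin n → ℝ)
    (z : (Fin (m + 1) × Fin n → ℝ) × (Fin m → Fin p → ℝ)) : ℝ :=
  fderiv ℝ (fderiv ℝ fun x => Real.log (S.jointDensity m x z.2)) z.1 v v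

lemma measurable_logDensity (hS : S.Regular) (m : ℕ) : Measurable (S.logDensity m) :=
  (measurable_jointDensity hS m).log

/-- Directions `(v, 0)` move the trajectory and leave the measurements fixed, so smoothness in the
measurements is never used. -/
lemma hasLineDerivAt_logDensity (hS : S.Regular) (m : ℕ) (v : Fin (m + 1) × Fin n → ℝ)
    (z : (Fin (m + 1) × Fin n → ℝ) × (Fin m → Fin p → ℝ)) :
    HasLineDerivAt ℝ (S.logDensity m) (S.score m v z) z (v, 0) := by
  have h := ((twiceDifferentiable_log_jointDensity hS m z.2).1 z.1).hasFDerivAt.hasLineDerivAt v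
  simpa [HasLineDerivAt, logDensity, score] using h

lemma hasLineDerivAt_score (hS : S.Regular) (m : ℕ) (v : Fin (m + 1) × Fin n → ℝ)
    (z : (Fin (m + 1) × Fin n → ℝ) × (Fin m → Fin p → ℝ)) :
    HasLineDerivAt ℝ (S.score m v) (S.scoreDeriv m v z) z (v, 0) := by
  have h := ((twiceDifferentiable_log_jointDensity hS m z.2).hasFDerivAt_fderiv_apply
    z.1 v).hasLineDerivAt v
  simpa [HasLineDerivAt, score, scoreDeriv] using h

lemma measurable_score (hS : S.Regular) (m : ℕ) (v : Fin (m + 1) × Fin n → ℝ) :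
    Measurable (S.score m v) :=
  measurable_of_hasLineDerivAt (measurable_logDensity hS m) (hasLineDerivAt_logDensity hS m v)

lemma measurable_scoreDeriv (hS : S.Regular) (m : ℕ) (v : Fin (m + 1) × Fin n → ℝ) :
    Measurable (S.scoreDeriv m v) :=
  measurable_of_hasLineDerivAt (measurable_score hS m v) (hasLineDerivAt_score hS m v)

lemma neg_scoreDeriv_history (hS : S.Regular) (m : ℕ) (v : Fin (m + 1) × Fin n → ℝ) (ω : Ω) :
    -S.scoreDeriv m v (history X Y m ω) = v ⬝ᵥ S.trajHess X Y m ω *ᵥ v := by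
  rw [trajHess, neg_mulVec, dotProduct_neg,
    dotProduct_hessian_mulVec (twiceDifferentiable_log_jointDensity hS _ _)]
  rfl

variable [MeasurableSpace Ω] {μ : Measure Ω} [IsProbabilityMeasure μ]

lemma map_history_eq_exp (hS : S.Regular) (h : S.Follows μ X Y W N) (m : ℕ) :
    μ.map (history X Y m) =
      volume.withDensity fun z => ENNReal.ofReal (Real.exp (S.logDensity m z)) := by
  simp only [logDensity, Real.exp_log (jointDensity_pos hS m _ _)]
  exact map_history hS h m

/-- The Fisher information identity for the trajectory. -/
theorem memLp_score_and_integral_score_sq (hS : S.Regular) (h : S.Follows μ X Y W N) {m : ℕ}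
    (hm : HasExpectation μ (S.trajHess X Y m)) (v : Fin (m + 1) × Fin n → ℝ) :
    MemLp (fun ω => S.score m v (history X Y m ω)) 2 μ ∧
      ∫ ω, S.score m v (history X Y m ω) ^ 2 ∂μ = v ⬝ᵥ S.infoMatrix μ X Y m *ᵥ v := by
  have hh := measurable_history hS h m
  have : IsProbabilityMeasure (μ.map (history X Y m)) :=
    Measure.isProbabilityMeasure_map hh.aemeasurable
  have hti : Integrable (S.scoreDeriv m v) (μ.map (history X Y m)) := by
    rw [integrable_map_measure (measurable_scoreDeriv hS m v).aestronglyMeasurable hh.aemeasurable]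
    refine (dotProduct_expectation_mulVec hm v).1.neg.congr (.of_forall fun ω => ?_)
    simp only [Pi.neg_apply, ← neg_scoreDeriv_history hS, neg_neg, Function.comp_apply]
  rw [map_history_eq_exp hS h m] at this hti
  obtain ⟨h1, h2⟩ := memLp_score_and_integral_sq (measurable_logDensity hS m)
    (hasLineDerivAt_logDensity hS m v) (hasLineDerivAt_score hS m v) hti
  rw [← map_history_eq_exp hS h m] at h1 h2
  rw [integral_map hh.aemeasurable ((measurable_score hS m v).pow_const 2).aestronglyMeasurable,
    integral_map hh.aemeasurable (f := fun z => -S.scoreDeriv m v z)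
      (measurable_scoreDeriv hS m v).neg.aestronglyMeasurable] at h2
  refine ⟨h1.comp_of_map hh.aemeasurable, h2.trans ?_⟩
  simp only [neg_scoreDeriv_history hS]
  exact (dotProduct_expectation_mulVec hm v).2

/-- The correlation of the prediction error with the score. -/
theorem integral_error_mul_score (hS : S.Regular) (h : S.Follows μ X Y W N) {k : ℕ}
    (hm : HasExpectation μ (S.trajHess X Y (k + 1))) (v : Fin (k + 2) × Fin n → ℝ)
    {g : (Fin (k + 1) → Fin p → ℝ) → Fin n → ℝ} (hg : Measurable g) (a : Fin n → ℝ)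
    (he : MemLp (fun ω => a ⬝ᵥ predError X Y k g ω) 2 μ) :
    ∫ ω, (a ⬝ᵥ predError X Y k g ω) * S.score (k + 1) v (history X Y (k + 1) ω) ∂μ =
      a ⬝ᵥ stateAt (Fin.last (k + 1)) v := by
  have hh := measurable_history hS h (k + 1)
  have hprob : IsProbabilityMeasure (μ.map (history X Y (k + 1))) :=
    Measure.isProbabilityMeasure_map hh.aemeasurable
  have hs2 : MemLp (S.score (k + 1) v) 2 (μ.map (history X Y (k + 1))) :=
    (memLp_map_measure_iff (measurable_score hS _ v).aestronglyMeasurable hh.aemeasurable).2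
      (memLp_score_and_integral_score_sq hS h hm v).1
  let e : (Fin (k + 2) × Fin n → ℝ) × (Fin (k + 1) → Fin p → ℝ) → ℝ := fun z =>
    a ⬝ᵥ (g z.2 - stateAt (Fin.last (k + 1)) z.1)
  have hem : Measurable e := by
    have : Measurable fun z : (Fin (k + 2) × Fin n → ℝ) × (Fin (k + 1) → Fin p → ℝ) =>
        g z.2 - stateAt (Fin.last (k + 1)) z.1 :=
      (hg.comp measurable_snd).sub ((stateAt _).measurable.comp measurable_fst)
    exact Finset.measurable_sum _ fun b _ => ((measurable_pi_apply b).comp this).const_mul _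
  have he2 : MemLp e 2 (μ.map (history X Y (k + 1))) :=
    (memLp_map_measure_iff hem.aestronglyMeasurable hh.aemeasurable).2 he
  -- The predictor depends on the measurements alone, so along `(v, 0)` the error is affine with
  -- slope minus the final state of `v`.
  have hd : ∀ z, HasLineDerivAt ℝ e (-(a ⬝ᵥ stateAt (Fin.last (k + 1)) v)) z (v, 0) := fun z => by
    have h1 : ∀ t : ℝ, e (z + t • (v, 0)) =
        e z + t * -(a ⬝ᵥ stateAt (Fin.last (k + 1)) v) := fun t => by
      simp only [e, Prod.snd_add, Prod.smul_snd, smul_zero, add_zero, Prod.fst_add, Prod.smul_fst,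
        map_add, map_smul, dotProduct_sub, dotProduct_add, dotProduct_smul, smul_eq_mul]
      ring
    simp only [HasLineDerivAt, h1]
    simpa using ((hasDerivAt_id (0 : ℝ)).mul_const
      (-(a ⬝ᵥ stateAt (Fin.last (k + 1)) v))).const_add (e z)
  rw [map_history_eq_exp hS h] at hs2 he2 hprob
  have := integral_mul_score_eq_neg (measurable_logDensity hS (k + 1))
    (hasLineDerivAt_logDensity hS (k + 1) v) hs2 hd he2
  rw [← map_history_eq_exp hS h, integral_map hh.aemeasurable
    (f := fun z => e z * S.score (k + 1) v z)
    (hem.mul (measurable_score hS _ v)).aestronglyMeasurable, neg_neg] at this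
  exact this

/-! ### Blocks of the information matrix -/

omit [IsProbabilityMeasure μ]

lemma infoMatrix_mulVec_dropLast (m : ℕ) (x : Fin (m + 1) × Fin n → ℝ) :
    dropLast (S.infoMatrix μ X Y m *ᵥ x) =
      S.blockA μ X Y m *ᵥ dropLast x + S.blockB μ X Y m *ᵥ stateAt (Fin.last m) x := by
  ext s
  exact dotProduct_eq_sum_castSucc_add_last _ _

lemma infoMatrix_mulVec_stateAt_last (hS : S.Regular) (m : ℕ) (x : Fin (m + 1) × Fin n → ℝ) :
    stateAt (Fin.last m) (S.infoMatrix μ X Y m *ᵥ x) =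
      (S.blockB μ X Y m)ᵀ *ᵥ dropLast x + S.blockC μ X Y m *ᵥ stateAt (Fin.last m) x := by
  ext a
  refine (dotProduct_eq_sum_castSucc_add_last _ _).trans ?_
  congr 1
  refine Finset.sum_congr rfl fun s _ => ?_
  simp only [transpose_apply, blockB, of_apply, dropLast_apply]
  rw [infoMatrix_symm hS]

/-- The block structure is expressed through the action on vectors, here and in the next two lemmas,
so that inverses can be handled by exhibiting solutions of linear systems. -/
lemma blockA_succ_mulVec (hS : S.Regular) {m : ℕ} (hm : HasExpectation μ (S.trajHess X Y m))
    (h11 : HasExpectation μ (S.hess11 X Y m)) (x : Fin (m + 1) × Fin n → ℝ) :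
    S.blockA μ X Y (m + 1) *ᵥ x = S.infoMatrix μ X Y m *ᵥ x +
      appendState 0 (S.D11 μ X Y m *ᵥ stateAt (Fin.last m) x) := by
  ext s
  obtain ⟨i, a⟩ := s
  have : (fun t => S.blockA μ X Y (m + 1) (i, a) t) = (fun t => S.infoMatrix μ X Y m (i, a) t) +
      fun t => if i = Fin.last m ∧ t.1 = Fin.last m then S.D11 μ X Y m a t.2 else 0 :=
    funext fun t => infoMatrix_castSucc_castSucc hS hm h11 i t.1 a t.2
  change (fun t => S.blockA μ X Y (m + 1) (i, a) t) ⬝ᵥ x = _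
  rw [this, add_dotProduct]
  congr 1
  rw [dotProduct_eq_sum_castSucc_add_last]
  refine Fin.lastCases ?_ (fun i => ?_) i
  · simp [dropLast_apply, stateAt_apply, dotProduct, mulVec, (Fin.castSucc_lt_last _).ne]
  · simp [dropLast_apply, stateAt_apply, dotProduct, (Fin.castSucc_lt_last _).ne]

lemma blockB_succ_mulVec (hS : S.Regular) (m : ℕ) (w : Fin n → ℝ) :
    S.blockB μ X Y (m + 1) *ᵥ w = appendState 0 (S.D12 μ X m *ᵥ w) := by
  ext s
  obtain ⟨i, a⟩ := s
  simp only [mulVec, dotProduct, blockB, of_apply, infoMatrix_castSucc_last hS]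
  refine Fin.lastCases ?_ (fun i => ?_) i
  · simp [mulVec, dotProduct]
  · simp [(Fin.castSucc_lt_last _).ne]

lemma blockB_succ_transpose_mulVec (hS : S.Regular) (m : ℕ) (x : Fin (m + 1) × Fin n → ℝ) :
    (S.blockB μ X Y (m + 1))ᵀ *ᵥ x = S.D21 μ X m *ᵥ stateAt (Fin.last m) x := by
  ext a
  simp only [mulVec, transpose_apply, blockB, of_apply, infoMatrix_castSucc_last hS, D21]
  rw [dotProduct_eq_sum_castSucc_add_last]
  simp [dropLast_apply, stateAt_apply, dotProduct, (Fin.castSucc_lt_last _).ne]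

lemma predInfo_mulVec (m : ℕ) (w : Fin n → ℝ) :
    S.predInfo μ X Y m *ᵥ w = S.blockC μ X Y m *ᵥ w - (S.blockB μ X Y m)ᵀ *ᵥ
      ((S.blockA μ X Y m)⁻¹ *ᵥ (S.blockB μ X Y m *ᵥ w)) := by
  simp only [predInfo, sub_mulVec, mulVec_mulVec, Matrix.mul_assoc]

/-- The Schur complement recursion. -/
theorem predInfo_succ (hS : S.Regular) {m : ℕ} (hm : HasExpectation μ (S.trajHess X Y m))
    (h11 : HasExpectation μ (S.hess11 X Y m)) (hA : IsUnit (S.blockA μ X Y m))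
    (hA' : IsUnit (S.blockA μ X Y (m + 1)))
    (hD : IsUnit (S.D11 μ X Y m + S.predInfo μ X Y m)) :
    S.predInfo μ X Y (m + 1) = S.D22 μ X m -
      S.D21 μ X m * (S.D11 μ X Y m + S.predInfo μ X Y m)⁻¹ * S.D12 μ X m := by
  rw [Matrix.ext_iff_mulVec]
  intro c
  rw [predInfo_mulVec, blockC_succ hS, blockB_succ_transpose_mulVec hS, sub_mulVec,
    ← mulVec_mulVec, ← mulVec_mulVec]
  set w := (S.D11 μ X Y m + S.predInfo μ X Y m)⁻¹ *ᵥ S.D12 μ X m *ᵥ c with hw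
  have hDw : S.D11 μ X Y m *ᵥ w + S.predInfo μ X Y m *ᵥ w = S.D12 μ X m *ᵥ c := by
    rw [← add_mulVec, hw, mulVec_mulVec, Matrix.mul_nonsing_inv _ (isUnit_iff_isUnit_det _ |>.1 hD),
      one_mulVec]
  set u := (S.blockA μ X Y m)⁻¹ *ᵥ (S.blockB μ X Y m *ᵥ w) with hu
  have hAu : S.blockA μ X Y m *ᵥ u = S.blockB μ X Y m *ᵥ w := by
    rw [hu, mulVec_mulVec, Matrix.mul_nonsing_inv _ (isUnit_iff_isUnit_det _ |>.1 hA), one_mulVec]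
  -- Block elimination: the earlier rows read `-A u + B w = 0`, and the last row reads `-Bᵀ u + C w
  -- + D¹¹ w`, that is `(J + D¹¹) w`, which is `D¹² c`.
  have key : S.blockA μ X Y (m + 1) *ᵥ appendState (-u) w = S.blockB μ X Y (m + 1) *ᵥ c := by
    rw [blockA_succ_mulVec hS hm h11, blockB_succ_mulVec hS, stateAt_last_appendState]
    have h1 := infoMatrix_mulVec_dropLast (S := S) (μ := μ) (X := X) (Y := Y) m
      (appendState (-u) w)
    have h2 := infoMatrix_mulVec_stateAt_last (μ := μ) (X := X) (Y := Y) hS m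
      (appendState (-u) w)
    rw [dropLast_appendState, stateAt_last_appendState, mulVec_neg] at h1 h2
    rw [hAu, neg_add_cancel] at h1
    rw [← hDw, predInfo_mulVec]
    ext s
    obtain ⟨i, a⟩ := s
    refine Fin.lastCases ?_ (fun i => ?_) i
    · have := congrFun h2 a
      simp only [stateAt_apply] at this
      simp only [Pi.add_apply, appendState_last, this, Pi.sub_apply, Pi.neg_apply, ← hu]
      ring
    · have := congrFun h1 (i, a)
      simp only [dropLast_apply] at this
      simp [this]
  -- Thus `(-u, w)` is `A_{m+1}⁻¹ B_{m+1} c`, and `B_{m+1}ᵀ` sees only its last component `w`.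
  rw [← key, mulVec_mulVec, Matrix.nonsing_inv_mul _ (isUnit_iff_isUnit_det _ |>.1 hA'), one_mulVec,
    stateAt_last_appendState]

/-! ### Positivity and the bound -/

lemma predInfo_symm (hS : S.Regular) (m : ℕ) : (S.predInfo μ X Y m).IsHermitian := by
  have hA : (S.blockA μ X Y m).IsHermitian := .ext fun s t => infoMatrix_symm hS _ _ _
  have hC : (S.blockC μ X Y m).IsHermitian := .ext fun s t => infoMatrix_symm hS _ _ _
  exact hC.sub (isHermitian_conjTranspose_mul_mul (S.blockB μ X Y m) hA.inv)

lemma dotProduct_infoMatrix_mulVec (hS : S.Regular) (m : ℕ) (u : Fin m × Fin n → ℝ)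
    (w : Fin n → ℝ) :
    appendState u w ⬝ᵥ S.infoMatrix μ X Y m *ᵥ appendState u w =
      u ⬝ᵥ (S.blockA μ X Y m *ᵥ u + S.blockB μ X Y m *ᵥ w) +
        w ⬝ᵥ ((S.blockB μ X Y m)ᵀ *ᵥ u + S.blockC μ X Y m *ᵥ w) := by
  rw [dotProduct_eq_sum_castSucc_add_last, infoMatrix_mulVec_dropLast,
    infoMatrix_mulVec_stateAt_last hS]
  simp

variable [IsProbabilityMeasure μ]

/-- By the Fisher identity the quadratic form at a direction `(u, 0)` is the expected square of a
score. -/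
lemma posSemidef_blockA (hS : S.Regular) (h : S.Follows μ X Y W N) {m : ℕ}
    (hm : HasExpectation μ (S.trajHess X Y m)) : (S.blockA μ X Y m).PosSemidef := by
  refine .of_dotProduct_mulVec_nonneg (Matrix.IsHermitian.ext fun s t => ?_) fun u => ?_
  · exact infoMatrix_symm hS _ _ _
  · have h1 := (memLp_score_and_integral_score_sq hS h hm (appendState u 0)).2
    rw [dotProduct_infoMatrix_mulVec hS] at h1
    simp only [mulVec_zero, add_zero, zero_dotProduct] at h1
    rw [star_trivial, ← h1]
    exact integral_nonneg fun ω => sq_nonneg _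

/-- The recursion also uses the inverse of `A_m`, whereas only `A_{m+1}` is assumed invertible.
Positive semidefinite and invertible means positive definite, and this passes to the principal
submatrix `A_m`, which the corner term `D¹¹` does not reach. -/
lemma isUnit_blockA_of_succ (hS : S.Regular) (h : S.Follows μ X Y W N) {m : ℕ}
    (hm : HasExpectation μ (S.trajHess X Y m)) (h11 : HasExpectation μ (S.hess11 X Y m))
    (hm' : HasExpectation μ (S.trajHess X Y (m + 1)))
    (hA' : IsUnit (S.blockA μ X Y (m + 1))) : IsUnit (S.blockA μ X Y m) := by
  have hpd := (posSemidef_blockA hS h hm').posDef_iff_isUnit.2 hA'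
  have hinj : Function.Injective fun s : Fin m × Fin n => (s.1.castSucc, s.2) :=
    (Fin.castSucc_injective m).prodMap Function.injective_id
  have heq : S.blockA μ X Y m = (S.blockA μ X Y (m + 1)).submatrix
      (fun s => (s.1.castSucc, s.2)) fun s => (s.1.castSucc, s.2) := by
    ext s t
    simp only [blockA, submatrix_apply, of_apply, infoMatrix_castSucc_castSucc hS hm h11]
    simp [(Fin.castSucc_lt_last _).ne]
  rw [heq]
  exact (hpd.submatrix hinj).isUnit

/-- The posterior Cramér–Rao bound for one-step-ahead prediction. -/
theorem posSemidef_errorOuter_sub_inv (hS : S.Regular) (h : S.Follows μ X Y W N) {k : ℕ}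
    (hm : HasExpectation μ (S.trajHess X Y (k + 1))) (hA : IsUnit (S.blockA μ X Y (k + 1)))
    (hJ : IsUnit (S.predInfo μ X Y (k + 1)))
    {g : (Fin (k + 1) → Fin p → ℝ) → Fin n → ℝ} (hg : Measurable g)
    (he : HasExpectation μ (errorOuter X Y k g)) :
    (expectation μ (errorOuter X Y k g) - (S.predInfo μ X Y (k + 1))⁻¹).PosSemidef := by
  refine .of_dotProduct_mulVec_nonneg (.sub ?_ (predInfo_symm hS _).inv) fun a => ?_
  · refine .ext fun i j => ?_
    simp [expectation, errorOuter, vecMulVec_apply, mul_comm]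
  rw [star_trivial, sub_mulVec, dotProduct_sub]
  set w := (S.predInfo μ X Y (k + 1))⁻¹ *ᵥ a with hw
  have hJw : S.predInfo μ X Y (k + 1) *ᵥ w = a := by
    rw [hw, mulVec_mulVec, Matrix.mul_nonsing_inv _ (isUnit_iff_isUnit_det _ |>.1 hJ), one_mulVec]
  set u := (S.blockA μ X Y (k + 1))⁻¹ *ᵥ (S.blockB μ X Y (k + 1) *ᵥ w) with hu
  have hAu : S.blockA μ X Y (k + 1) *ᵥ u = S.blockB μ X Y (k + 1) *ᵥ w := by
    rw [hu, mulVec_mulVec, Matrix.mul_nonsing_inv _ (isUnit_iff_isUnit_det _ |>.1 hA), one_mulVec]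
  have hpred : S.predInfo μ X Y (k + 1) *ᵥ w = S.blockC μ X Y (k + 1) *ᵥ w -
      (S.blockB μ X Y (k + 1))ᵀ *ᵥ u := predInfo_mulVec _ _
  have hquad : ∀ ω, a ⬝ᵥ errorOuter X Y k g ω *ᵥ a = (a ⬝ᵥ predError X Y k g ω) ^ 2 := fun ω => by
    rw [errorOuter, vecMulVec_mulVec, dotProduct_smul, dotProduct_comm _ a, sq]
    rfl
  obtain ⟨he1, he2⟩ := dotProduct_expectation_mulVec he a
  simp only [hquad] at he1 he2
  have hem : Measurable fun ω => a ⬝ᵥ predError X Y k g ω := by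
    have hh := measurable_history hS h (k + 1)
    have h1 : Measurable (predError X Y k g) :=
      (hg.comp hh.snd).sub ((stateAt (Fin.last (k + 1))).measurable.comp hh.fst)
    exact Finset.measurable_sum _ fun b _ => ((measurable_pi_apply b).comp h1).const_mul _
  have heL : MemLp (fun ω => a ⬝ᵥ predError X Y k g ω) 2 μ :=
    (memLp_two_iff_integrable_sq hem.aestronglyMeasurable).2 he1
  -- The direction `(u, -w)` is chosen so that the information matrix maps it to `(0, -a)`. Its
  -- quadratic form is therefore `w ⬝ a = aᵀ J⁻¹ a`, and its correlation with the error is `-(a ⬝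
  -- w)`.
  have hcross := integral_error_mul_score hS h hm (appendState u (-w)) hg a heL
  obtain ⟨hs1, hs2⟩ := memLp_score_and_integral_score_sq hS h hm (appendState u (-w))
  rw [dotProduct_infoMatrix_mulVec hS, hAu, mulVec_neg, add_neg_cancel, dotProduct_zero, zero_add,
    mulVec_neg, ← sub_eq_add_neg, ← neg_sub, neg_dotProduct_neg, ← hpred,
    hJw] at hs2
  rw [stateAt_last_appendState, dotProduct_neg] at hcross
  have hcrossI : Integrable (fun ω => (a ⬝ᵥ predError X Y k g ω) *
    S.score (k + 1) (appendState u (-w)) (history X Y (k + 1) ω)) μ := heL.integrable_mul hs1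
  have hnn : 0 ≤ ∫ ω, (a ⬝ᵥ predError X Y k g ω +
      S.score (k + 1) (appendState u (-w)) (history X Y (k + 1) ω)) ^ 2 ∂μ :=
    integral_nonneg fun ω => sq_nonneg _
  have hexp : ∀ ω, (a ⬝ᵥ predError X Y k g ω +
      S.score (k + 1) (appendState u (-w)) (history X Y (k + 1) ω)) ^ 2 =
      (a ⬝ᵥ predError X Y k g ω) ^ 2 + 2 * ((a ⬝ᵥ predError X Y k g ω) *
      S.score (k + 1) (appendState u (-w)) (history X Y (k + 1) ω)) +
      S.score (k + 1) (appendState u (-w)) (history X Y (k + 1) ω) ^ 2 := fun ω => by ring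
  simp only [hexp] at hnn
  -- The expanded square reads `0 ≤ aᵀ P a - 2 aᵀ J⁻¹ a + aᵀ J⁻¹ a`.
  rw [integral_add (by exact he1.add (hcrossI.const_mul 2)) hs1.integrable_sq,
    integral_add he1 (hcrossI.const_mul 2), integral_const_mul, he2, hcross, hs2,
    dotProduct_comm w a] at hnn
  linarith

end System

end PredictivePCRB

end

open PredictivePCRB in
theorem proposition1 {n p : ℕ} {U : Type*} (S : System n p U) (hS : S.Regular)
    {Ω : Type*} [MeasurableSpace Ω] (μ : Measure Ω) [IsProbabilityMeasure μ]
    (X : ℕ → Ω → Fin n → ℝ) (Y : ℕ → Ω → Fin p → ℝ)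
    (W : ℕ → Ω → Fin n → ℝ) (N : ℕ → Ω → Fin p → ℝ)
    (hXY : S.Follows μ X Y W N)
    (hprior : HasExpectation μ (S.priorHess X)) :
    S.predInfo μ X Y 0 = expectation μ (S.priorHess X) ∧
    ∀ k : ℕ,
      (∀ j ≤ k, HasExpectation μ (S.hess11 X Y j) ∧ HasExpectation μ (S.hess12 X j) ∧
        HasExpectation μ (S.hess22 X j)) →
      IsUnit (S.blockA μ X Y (k + 1)) →
      IsUnit (S.D11 μ X Y k + S.predInfo μ X Y k) →
      IsUnit (S.predInfo μ X Y (k + 1)) →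
      S.predInfo μ X Y (k + 1) =
          S.D22 μ X k - S.D21 μ X k * (S.D11 μ X Y k + S.predInfo μ X Y k)⁻¹ * S.D12 μ X k ∧
      ∀ g : (Fin (k + 1) → Fin p → ℝ) → Fin n → ℝ, Measurable g →
        HasExpectation μ (errorOuter X Y k g) →
        (expectation μ (errorOuter X Y k g) - (S.predInfo μ X Y (k + 1))⁻¹).PosSemidef := by
  refine ⟨System.predInfo_zero hS, fun k hD hA hDJ hJ => ?_⟩
  have hm := System.hasExpectation_trajHess hS hprior k fun j hj => hD j hj.le
  have hm' := System.hasExpectation_trajHess hS hprior (k + 1) fun j hj =>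
    hD j (Nat.le_of_lt_succ hj)
  have h11 := (hD k le_rfl).1
  exact ⟨System.predInfo_succ hS hm h11 (System.isUnit_blockA_of_succ hS hXY hm h11 hm' hA) hA hDJ,
    fun g hg he => System.posSemidef_errorOuter_sub_inv hS hXY hm' hA hJ hg he⟩
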